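/- Let $k$ be a commutative ring. A twisted complex (multicomplex) $X$ of $k$-modules in the right half plane is a family of $k$-modules $X_{p,q}$, $p,q\in\mathbb Z$, with $X_{p,q}=0$ for $p<0$, together with $k$-linear maps $d_i\colon X_{p,q}\to X_{p-i,q+i-1}$, $i\ge 0$, such that $\sum_{i+j=n}d_id_j=0$ for all $n\ge 0$. A morphism is a family of $k$-linear maps $f_{p,q}\colon X_{p,q}\to Y_{p,q}$ commuting with all $d_i$; let $\operatorname{tCh}$ be the resulting category. The total complex $\operatorname{Tot}(X)$ has $\operatorname{Tot}(X)_n=\bigoplus_{p+q=n}X_{p,q}$ with differential $\sum_{i\ge0}d_i$, and the vertical homology $H^v_{p,q}(X)$ is the homology of $(X_{p,*},d_0)$ in degree $q$. For $p\ge0$, $q\in\mathbb Z$, the twisted disc $\tilde D^{p,q}$ is the twisted complex freely generated by one element $x_{p,q}$ of bidegree $(p,q)$, its vertical boundary $\partial_v\tilde D^{p,q}$ is the twisted complex freely generated by one element $y_{p,q-1}$ of bidegree $(p,q-1)$ with $d_0(y_{p,q-1})=0$, and $\partial_v\tilde D^{p,q}\to\tilde D^{p,q}$ is the morphism with $y_{p,q-1}\mapsto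 d_0(x_{p,q})$. **Theorem.** The category $\operatorname{tCh}$ is complete and cocomplete and carries a model structure, with functorial factorizations, which is (left and right) proper, combinatorial (i.e. $\operatorname{tCh}$ is locally presentable and the model structure is cofibrantly generated) and abelian (i.e. $\operatorname{tCh}$ is an abelian category, the (trivial) cofibrations are exactly the monomorphisms with (trivially) cofibrant cokernel, and the (trivial) fibrations are exactly the epimorphisms with (trivially) fibrant kernel), such that: - a morphism $f$ is a weak equivalence if and only if $\operatorname{Tot}(f)$ is a quasi-isomorphism; - a morphism $f$ is a fibration (resp. a trivial fibration) if and only if every $f_{p,q}$ is surjective and $H^v_{p,q}(f)$ is an isomorphism for all $p>0$ (resp. all $p\ge0$) and all $q\in\mathbb Z$; - a morphism $f$ is a cofibration if and only if every $f_{p,q}$ is injective and the cokernel of $f$ is cofibrant; if $X$ is cofibrant, then every $X_{p,q}$ is a projective $k$-module; - $I=\{\partial_v\tilde D^{p,q}\to\tilde D^{p,q}\}_{p\ge0,\,q\in\mathbb Z}$ is a set of generating cofibrations and $J=\{0\to\tilde D^{0,q}\}_{q\in\mathbb Z}\cup\{\partial_v\tilde D^{p,q}\to\tilde D^{p,q}\}_{p>0,\,q\in\mathbb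 Z}$ is a set of generating trivial cofibrations, that is, the trivial fibrations (resp. the fibrations) are exactly the morphisms with the right lifting property with respect to $I$ (resp. $J$). Moreover, the maps $\partial_v\tilde D^{p,q}\to\tilde D^{p,q}$ are injective for all $p\ge0$, $q\in\mathbb Z$, and $H_*(\operatorname{Tot}(\partial_v\tilde D^{p,q}))=0$ for all $p>0$, $q\in\mathbb Z$. -/

import Mathlib

open CategoryTheory Limits HomotopicalAlgebra

universe u

noncomputable section

/-! ### Twisted complexes -/

/-- A twisted complex (multicomplex) of `k`-modules in the right half plane.
The component of `d_i` from bidegree `(p, q)` to `(p', q')` is `d i p q p' q'`; it can only be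
nonzero if `(p', q') = (p - i, q + i - 1)`. -/
structure TwistedComplex (k : Type u) [CommRing k] where
  /-- the module in bidegree `(p, q)` -/
  X : ℤ → ℤ → ModuleCat.{u} k
  /-- the maps `d_i` -/
  d (i : ℕ) (p q p' q' : ℤ) : X p q ⟶ X p' q'
  isZero_of_neg (p q : ℤ) (hp : p < 0) : IsZero (X p q)
  shape (i : ℕ) (p q p' q' : ℤ) (h : ¬ (p' + i = p ∧ q' + 1 = q + i)) : d i p q p' q' = 0
  /-- `∑_{i + j = n} d_i d_j = 0`; here `ij = (i, j)` -/
  sum_d_comp_d (n : ℕ) (p q p'' q'' : ℤ) :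
    ∑ ij ∈ Finset.HasAntidiagonal.antidiagonal n,
      d ij.2 p q (p - ij.2) (q + ij.2 - 1) ≫ d ij.1 (p - ij.2) (q + ij.2 - 1) p'' q'' = 0

namespace TwistedComplex

variable {k : Type u} [CommRing k]

/-- Morphisms of twisted complexes: families of linear maps commuting with all `d_i`. -/
@[ext]
structure Hom (A B : TwistedComplex k) where
  /-- the component in bidegree `(p, q)` -/
  f (p q : ℤ) : A.X p q ⟶ B.X p q
  comm (i : ℕ) (p q p' q' : ℤ) : f p q ≫ B.d i p q p' q' = A.d i p q p' q' ≫ f p' q'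

/-- The category of twisted complexes. -/
instance : Category (TwistedComplex k) where
  Hom A B := Hom A B
  id A := { f := fun p q => 𝟙 (A.X p q), comm := by simp }
  comp F G :=
    { f := fun p q => F.f p q ≫ G.f p q
      comm := fun i p q p' q' => by
        rw [Category.assoc, G.comm, ← Category.assoc, F.comm, Category.assoc] }
  id_comp F := Hom.ext (by funext p q; simp)
  comp_id F := Hom.ext (by funext p q; simp)
  assoc F G H := Hom.ext (by funext p q; simp)

@[ext]
theorem hom_ext {A B : TwistedComplex k} {F G : A ⟶ B} (h : ∀ p q, F.f p q = G.f p q) : F = G :=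
  Hom.ext (by funext p q; exact h p q)

@[simp]
theorem id_f (A : TwistedComplex k) (p q : ℤ) : Hom.f (𝟙 A) p q = 𝟙 (A.X p q) := rfl

@[simp]
theorem comp_f {A B C : TwistedComplex k} (F : A ⟶ B) (G : B ⟶ C) (p q : ℤ) :
    (F ≫ G).f p q = F.f p q ≫ G.f p q := rfl

section Preadditive

variable (A B : TwistedComplex k)

instance : Zero (A ⟶ B) := ⟨{ f := fun _ _ => 0, comm := by simp }⟩
instance : Add (A ⟶ B) :=
  ⟨fun F G => { f := fun p q => F.f p q + G.f p q
                comm := by simp [F.comm, G.comm] }⟩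
instance : Neg (A ⟶ B) :=
  ⟨fun F => { f := fun p q => - F.f p q, comm := by simp [F.comm] }⟩

variable {A B}

@[simp]
theorem zero_f (p q : ℤ) : Hom.f (0 : A ⟶ B) p q = 0 := rfl

@[simp]
theorem add_f (F G : A ⟶ B) (p q : ℤ) : (F + G).f p q = F.f p q + G.f p q := rfl

@[simp]
theorem neg_f (F : A ⟶ B) (p q : ℤ) : (-F).f p q = - F.f p q := rfl

instance : AddCommGroup (A ⟶ B) where
  add_assoc F G H := hom_ext fun p q => by simp [add_assoc]
  zero_add F := hom_ext fun p q => by simp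
  add_zero F := hom_ext fun p q => by simp
  neg_add_cancel F := hom_ext fun p q => by simp
  add_comm F G := hom_ext fun p q => by simp [add_comm]
  nsmul := nsmulRec
  zsmul := zsmulRec

instance : Preadditive (TwistedComplex k) where
  add_comp _ _ _ _ _ _ := hom_ext fun p q => by simp
  comp_add _ _ _ _ _ _ := hom_ext fun p q => by simp

end Preadditive

theorem d_comp_d_congr (A : TwistedComplex k) {i j : ℕ} {p q s t s' t' p'' q'' : ℤ}
    (hs : s = s') (ht : t = t') :
    A.d j p q s t ≫ A.d i s t p'' q'' = A.d j p q s' t' ≫ A.d i s' t' p'' q'' := by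
  subst hs ht
  rfl

/-! ### Vertical complexes and the total complex -/

/-- The vertical complex `X_{p,*}` with differential `d_0`, as a functor. Its homology in degree
`q` is the vertical homology `H^v_{p,q}`. -/
def vertical (p : ℤ) : TwistedComplex k ⥤ ChainComplex (ModuleCat.{u} k) ℤ where
  obj A :=
    { X := fun q => A.X p q
      d := fun q q' => A.d 0 p q p q'
      shape := fun q q' h => A.shape _ _ _ _ _ fun h' => h (by simpa using h'.2)
      d_comp_d' := fun q q' q'' h _ => by
        obtain rfl : q' = q - 1 := by simp at h; omega
        have h := A.sum_d_comp_d 0 p q p q''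
        rw [Finset.Nat.antidiagonal_zero, Finset.sum_singleton] at h
        rw [← h]
        exact A.d_comp_d_congr (by simp) (by simp) }
  map F :=
    { f := fun q => F.f p q
      comm' := fun _ _ _ => F.comm _ _ _ _ _ }
  map_id _ := rfl
  map_comp _ _ := rfl

/-- `Tot(X)_n = ⨁_{p + q = n} X_{p,q}`; only `p ≥ 0` contributes. -/
abbrev TotX (A : TwistedComplex k) (n : ℤ) : Type u :=
  DirectSum ℕ fun p => A.X p (n - p)

/-- The differential `∑_i d_i` of the total complex, from degree `n` to degree `m`
(it vanishes unless `m + 1 = n`). On `X_{p,n-p}` it is the sum over `i + p' = p` of the maps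
`d_i` to `X_{p',m-p'}`. -/
def totD (A : TwistedComplex k) (n m : ℤ) : A.TotX n →ₗ[k] A.TotX m :=
  DirectSum.toModule k ℕ _ fun p =>
    ∑ ip ∈ Finset.HasAntidiagonal.antidiagonal p,
      DirectSum.lof k ℕ (fun p' : ℕ => A.X p' (m - p')) ip.2 ∘ₗ
        (A.d ip.1 p (n - p) ip.2 (m - ip.2)).hom

theorem totD_lof (A : TwistedComplex k) (n m : ℤ) (p : ℕ) (x : A.X p (n - p)) :
    A.totD n m (DirectSum.lof k ℕ (fun p : ℕ => A.X p (n - p)) p x) =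
      ∑ ip ∈ Finset.HasAntidiagonal.antidiagonal p,
        DirectSum.lof k ℕ (fun p' : ℕ => A.X p' (m - p')) ip.2
          ((A.d ip.1 p (n - p) ip.2 (m - ip.2)).hom x) := by
  simp [totD, DirectSum.toModule_lof]

theorem totD_eq_zero (A : TwistedComplex k) (n m : ℤ) (h : m + 1 ≠ n) : A.totD n m = 0 := by
  refine DirectSum.linearMap_ext k fun p => LinearMap.ext fun x => ?_
  rw [LinearMap.comp_apply, totD_lof]
  refine Finset.sum_eq_zero fun ip hip => ?_
  rw [Finset.HasAntidiagonal.mem_antidiagonal] at hip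
  rw [A.shape _ _ _ _ _ (by omega)]
  simp

theorem totD_comp_totD (A : TwistedComplex k) (n m l : ℤ) (h : m + 1 = n) :
    A.totD m l ∘ₗ A.totD n m = 0 := by
  refine DirectSum.linearMap_ext k fun p => LinearMap.ext fun x => ?_
  rw [LinearMap.comp_apply, LinearMap.comp_apply, totD_lof, map_sum]
  simp only [totD_lof]
  have key : ∀ np ∈ Finset.HasAntidiagonal.antidiagonal p,
      ∑ ij ∈ Finset.HasAntidiagonal.antidiagonal np.1,
        (A.d ij.1 (p - ij.2 : ℤ) (n - p + ij.2 - 1) np.2 (l - np.2)).hom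
          ((A.d ij.2 p (n - p) (p - ij.2) (n - p + ij.2 - 1)).hom x) = 0 := by
    intro np _
    have := congrArg (fun F => F.hom x) (A.sum_d_comp_d np.1 p (n - p) np.2 (l - np.2))
    simpa [ModuleCat.hom_sum] using this
  have h2 : ∑ np ∈ Finset.HasAntidiagonal.antidiagonal p,
      DirectSum.lof k ℕ (fun p' : ℕ => A.X p' (l - p')) np.2
        (∑ ij ∈ Finset.HasAntidiagonal.antidiagonal np.1,
          (A.d ij.1 (p - ij.2 : ℤ) (n - p + ij.2 - 1) np.2 (l - np.2)).hom
            ((A.d ij.2 p (n - p) (p - ij.2) (n - p + ij.2 - 1)).hom x)) = 0 :=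
    Finset.sum_eq_zero fun np hnp => by rw [key np hnp, map_zero]
  rw [LinearMap.zero_comp, LinearMap.zero_apply, ← h2]
  simp only [map_sum]
  rw [Finset.sum_sigma', Finset.sum_sigma']
  refine Finset.sum_bij'
    (fun a _ => ⟨(a.2.1 + a.1.1, a.2.2), (a.2.1, a.1.1)⟩)
    (fun b _ => ⟨(b.2.2, b.2.1 + b.1.2), (b.2.1, b.1.2)⟩) ?_ ?_ ?_ ?_ ?_
  · rintro ⟨⟨i, a⟩, ⟨j, b⟩⟩ h
    simp only [Finset.mem_sigma, Finset.HasAntidiagonal.mem_antidiagonal] at h ⊢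
    exact ⟨by have := h.1; have := h.2; lia, trivial⟩
  · rintro ⟨⟨i, a⟩, ⟨j, b⟩⟩ h
    simp only [Finset.mem_sigma, Finset.HasAntidiagonal.mem_antidiagonal] at h ⊢
    exact ⟨by have := h.1; have := h.2; lia, trivial⟩
  · rintro ⟨⟨i, a⟩, ⟨j, b⟩⟩ h
    simp only [Finset.mem_sigma, Finset.HasAntidiagonal.mem_antidiagonal] at h
    obtain ⟨rfl, rfl⟩ := h
    rfl
  · rintro ⟨⟨i, a⟩, ⟨j, b⟩⟩ h
    simp only [Finset.mem_sigma, Finset.HasAntidiagonal.mem_antidiagonal] at h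
    obtain ⟨rfl, rfl⟩ := h
    rfl
  · rintro ⟨⟨i, a⟩, ⟨j, b⟩⟩ h'
    simp only [Finset.mem_sigma, Finset.HasAntidiagonal.mem_antidiagonal] at h'
    obtain ⟨h1, h3⟩ := h'
    have e1 : (a : ℤ) = p - i := by omega
    have e2 : m - a = n - p + i - 1 := by omega
    dsimp only
    congr 1
    exact congrArg (fun F : A.X p (n - p) ⟶ A.X b (l - b) => F.hom x)
      (A.d_comp_d_congr (i := j) (j := i) (p := p) (q := n - p) (p'' := b) (q'' := l - b) e1 e2)

/-- The totalisation functor. -/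
def Tot : TwistedComplex k ⥤ ChainComplex (ModuleCat.{u} k) ℤ where
  obj A :=
    { X := fun n => ModuleCat.of k (A.TotX n)
      d := fun n m => ModuleCat.ofHom (A.totD n m)
      shape := fun n m h => by
        rw [A.totD_eq_zero n m h]; rfl
      d_comp_d' := fun n m l h _ => by
        rw [← ModuleCat.ofHom_comp, A.totD_comp_totD n m l h]; rfl }
  map {A B} F :=
    { f := fun n => ModuleCat.ofHom (DirectSum.lmap fun p : ℕ => (F.f p (n - p)).hom)
      comm' := fun n m _ => by
        refine ModuleCat.hom_ext (DirectSum.linearMap_ext k fun p => LinearMap.ext fun x => ?_)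
        change B.totD n m (DirectSum.lmap _ (DirectSum.lof k ℕ (fun p : ℕ => A.X p (n - p)) p x)) =
          DirectSum.lmap _ (A.totD n m (DirectSum.lof k ℕ (fun p : ℕ => A.X p (n - p)) p x))
        rw [DirectSum.lmap_lof, totD_lof, totD_lof, map_sum]
        refine Finset.sum_congr rfl fun ip _ => ?_
        rw [DirectSum.lmap_lof]
        congr 1
        exact congrArg (fun G => G.hom x) (F.comm ip.1 p (n - p) ip.2 (m - ip.2)) }
  map_id A := by
    refine HomologicalComplex.hom_ext _ _ fun n => ModuleCat.hom_ext
      (DirectSum.linearMap_ext k fun p => LinearMap.ext fun x => ?_)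
    exact DirectSum.lmap_lof _ _ _
  map_comp {A B C} F G := by
    refine HomologicalComplex.hom_ext _ _ fun n => ModuleCat.hom_ext
      (DirectSum.linearMap_ext k fun p => LinearMap.ext fun x => ?_)
    change DirectSum.lmap _ (DirectSum.lof k ℕ (fun p : ℕ => A.X p (n - p)) p x) =
      DirectSum.lmap (fun p : ℕ => (G.f p (n - p)).hom)
        (DirectSum.lmap (fun p : ℕ => (F.f p (n - p)).hom)
          (DirectSum.lof k ℕ (fun p : ℕ => A.X p (n - p)) p x))
    rw [DirectSum.lmap_lof, DirectSum.lmap_lof, DirectSum.lmap_lof]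
    rfl

/-! ### Twisted discs and their vertical boundaries

A word `[i_1, …, i_n]` stands for the element `d_{i_1} ⋯ d_{i_n}(x)`. -/

/-- The word `w`, applied to an element of bidegree `(p, q)`, lies in bidegree `(a, b)`
with `a ≥ 0`. -/
def IsWordOf (p q a b : ℤ) (w : List ℕ) : Prop :=
  0 ≤ a ∧ a + (w.sum : ℤ) = p ∧ b + (w.length : ℤ) = q + (w.sum : ℤ)

variable (k)

/-- A word as a basis element of the free module on all words. -/
def word (w : List ℕ) : List ℕ →₀ k := Finsupp.single w 1

/-- The relations in bidegree `(a, b)` of the twisted complex generated by an element `x` of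
bidegree `(p, q)` subject to `g(x) = 0` for the words `g ∈ G`, inside the free module on all words:
words not of bidegree `(a, b)` are zero, `∑_{i + j = m} u d_i d_j v (x) = 0`,
and `u g (x) = 0` for `g ∈ G`. -/
def relations (G : Set (List ℕ)) (p q a b : ℤ) : Submodule k (List ℕ →₀ k) :=
  Submodule.span k
    ({r | ∃ w, ¬ IsWordOf p q a b w ∧ r = word k w} ∪
     {r | ∃ (u v : List ℕ) (m : ℕ),
        r = ∑ ij ∈ Finset.HasAntidiagonal.antidiagonal m, word k (u ++ ij.1 :: ij.2 :: v)} ∪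
     {r | ∃ u, ∃ g ∈ G, r = word k (u ++ g)})

/-- `w ↦ d_i w` on the free module on words. -/
def consMap (i : ℕ) : (List ℕ →₀ k) →ₗ[k] (List ℕ →₀ k) :=
  Finsupp.lmapDomain k k (List.cons i)

/-- `w ↦ w d_0` on the free module on words. -/
def snocZeroMap : (List ℕ →₀ k) →ₗ[k] (List ℕ →₀ k) :=
  Finsupp.lmapDomain k k (fun w => w ++ [0])

@[simp]
theorem consMap_word (i : ℕ) (w : List ℕ) : consMap k i (word k w) = word k (i :: w) := by
  simp [consMap, word]

@[simp]
theorem snocZeroMap_word (w : List ℕ) : snocZeroMap k (word k w) = word k (w ++ [0]) := by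
  simp [snocZeroMap, word]

theorem relations_le_consMap (G : Set (List ℕ)) (p q : ℤ) (i : ℕ) (a b a' b' : ℤ)
    (h : a' + i = a ∧ b' + 1 = b + i) :
    relations k G p q a b ≤ (relations k G p q a' b').comap (consMap k i) := by
  refine Submodule.span_le.2 ?_
  rintro r ((⟨w, hw, rfl⟩ | ⟨u, v, m, rfl⟩) | ⟨u, g, hg, rfl⟩) <;>
    refine Submodule.subset_span ?_
  · refine Or.inl (Or.inl ⟨i :: w, fun hw' => hw ?_, by simp⟩)
    simp only [IsWordOf, List.sum_cons, List.length_cons, Nat.cast_add, Nat.cast_one] at hw' ⊢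
    omega
  · exact Or.inl (Or.inr ⟨i :: u, v, m, by simp⟩)
  · exact Or.inr ⟨i :: u, g, hg, by simp⟩

/-- The twisted complex generated by a single element of bidegree `(p, q)` subject to the
relations `g(x) = 0`, `g ∈ G`. -/
def cyclic (G : Set (List ℕ)) (p q : ℤ) : TwistedComplex k where
  X a b := ModuleCat.of k ((List ℕ →₀ k) ⧸ relations k G p q a b)
  d i a b a' b' :=
    open Classical in
    if h : a' + i = a ∧ b' + 1 = b + i then
      ModuleCat.ofHom (Submodule.mapQ _ _ (consMap k i) (relations_le_consMap k G p q i a b a' b' h))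
    else 0
  isZero_of_neg a b ha := by
    have : relations k G p q a b = ⊤ := by
      rw [eq_top_iff]
      intro r _
      induction r using Finsupp.induction_linear with
      | zero => exact Submodule.zero_mem _
      | add x y hx hy => exact Submodule.add_mem _ (hx trivial) (hy trivial)
      | single w c =>
        have : Finsupp.single w c = c • word k w := by simp [word]
        rw [this]
        refine Submodule.smul_mem _ _ (Submodule.subset_span (Or.inl (Or.inl ⟨w, ?_, rfl⟩)))
        intro hw
        exact absurd hw.1 (not_le.2 ha)
    have : Subsingleton ((List ℕ →₀ k) ⧸ relations k G p q a b) := by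
      rw [Submodule.Quotient.subsingleton_iff]; exact this
    exact ModuleCat.isZero_of_subsingleton _
  shape i a b a' b' h := by
    rw [dif_neg h]
  sum_d_comp_d n a b a'' b'' := by
    by_cases h : a'' + n = a ∧ b'' + 2 = b + n
    · refine ModuleCat.hom_ext (LinearMap.ext fun w => ?_)
      obtain ⟨w, rfl⟩ := Submodule.mkQ_surjective _ w
      induction w using Finsupp.induction_linear with
      | zero => simp
      | add x y hx hy => rw [map_add, map_add, hx, hy, map_add]
      | single w c =>
        have hc : Finsupp.single w c = c • word k w := by simp [word]
        rw [hc, map_smul, map_smul, map_smul]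
        congr 1
        rw [ModuleCat.hom_sum, LinearMap.sum_apply]
        have : ∀ ij ∈ Finset.HasAntidiagonal.antidiagonal n, a - (ij.2 : ℤ) + ij.2 = a ∧
            b + ij.2 - 1 + 1 = b + ij.2 ∧ a'' + ij.1 = a - ij.2 ∧
            b'' + 1 = b + ij.2 - 1 + ij.1 := by
          intro ij hij
          rw [Finset.HasAntidiagonal.mem_antidiagonal] at hij
          omega
        trans Submodule.mkQ (relations k G p q a'' b'')
          (∑ ij ∈ Finset.HasAntidiagonal.antidiagonal n, word k ([] ++ ij.1 :: ij.2 :: w))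
        · rw [map_sum]
          refine Finset.sum_congr rfl fun ij hij => ?_
          obtain ⟨h1, h2, h3, h4⟩ := this ij hij
          rw [dif_pos ⟨h1, h2⟩, dif_pos ⟨h3, h4⟩]
          simp [Submodule.mapQ_apply]
        · rw [Submodule.mkQ_apply, (Submodule.Quotient.mk_eq_zero _).2]
          · simp
          · exact Submodule.subset_span (Or.inl (Or.inr ⟨[], w, n, rfl⟩))
    · refine Finset.sum_eq_zero fun ij hij => ?_
      rw [Finset.HasAntidiagonal.mem_antidiagonal] at hij
      by_cases h' : a'' + ij.1 = a - ij.2 ∧ b'' + 1 = b + ij.2 - 1 + ij.1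
      · exact absurd h' (by omega)
      · rw [dif_neg h', comp_zero]

/-- The twisted disc `D̃^{p,q}`: freely generated by one element of bidegree `(p, q)`. -/
def disc (p q : ℤ) : TwistedComplex k := cyclic k ∅ p q

/-- The vertical boundary `∂_v D̃^{p,q}`: freely generated by one vertical cycle of bidegree
`(p, q - 1)`. -/
def boundary (p q : ℤ) : TwistedComplex k := cyclic k {[0]} p (q - 1)

theorem relations_le_snocZeroMap (p q a b : ℤ) :
    relations k {[0]} p (q - 1) a b ≤ (relations k ∅ p q a b).comap (snocZeroMap k) := by
  refine Submodule.span_le.2 ?_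
  rintro r ((⟨w, hw, rfl⟩ | ⟨u, v, m, rfl⟩) | ⟨u, g, rfl, rfl⟩) <;>
    refine Submodule.subset_span ?_
  · refine Or.inl (Or.inl ⟨w ++ [0], fun hw' => hw ?_, by simp⟩)
    simp only [IsWordOf, List.sum_append, List.length_append, List.sum_singleton,
      List.length_singleton, Nat.cast_add, Nat.cast_one, Nat.cast_zero] at hw' ⊢
    omega
  · exact Or.inl (Or.inr ⟨u, v ++ [0], m, by simp⟩)
  · exact Or.inl (Or.inr ⟨u, [], 0, by simp⟩)

/-- The inclusion `∂_v D̃^{p,q} ⟶ D̃^{p,q}` sending the generator `y` to `d_0(x)`. -/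
def boundaryInclusion (p q : ℤ) : boundary k p q ⟶ disc k p q where
  f a b := ModuleCat.ofHom
    (Submodule.mapQ _ _ (snocZeroMap k) (relations_le_snocZeroMap k p q a b))
  comm i a b a' b' := by
    by_cases h : a' + i = a ∧ b' + 1 = b + i
    · refine ModuleCat.hom_ext (LinearMap.ext fun w => ?_)
      obtain ⟨w, rfl⟩ := Submodule.mkQ_surjective _ w
      simp only [disc, boundary, cyclic, dif_pos h]
      change Submodule.mkQ _ (consMap k i (snocZeroMap k w)) =
        Submodule.mkQ _ (snocZeroMap k (consMap k i w))
      congr 1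
      induction w using Finsupp.induction_linear with
      | zero => simp
      | add x y hx hy => rw [map_add, map_add, hx, hy, map_add, map_add]
      | single w c => simp [consMap, snocZeroMap]
    · simp only [disc, boundary, cyclic, dif_neg h]
      exact comp_zero.trans zero_comp.symm

/-- The zero twisted complex. -/
def zero : TwistedComplex k where
  X _ _ := ModuleCat.of k PUnit
  d _ _ _ _ _ := 0
  isZero_of_neg _ _ _ := ModuleCat.isZero_of_subsingleton _
  shape _ _ _ _ _ _ := rfl
  sum_d_comp_d _ _ _ _ _ := by simp

/-- The maps `∂_v D̃^{p,q} ↪ D̃^{p,q}`, `p ≥ 0`. -/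
def generatingCofibrations : MorphismProperty (TwistedComplex k) :=
  MorphismProperty.ofHoms fun pq : ℕ × ℤ => boundaryInclusion k pq.1 pq.2

/-- The maps `0 ↪ D̃^{0,q}` and `∂_v D̃^{p,q} ↪ D̃^{p,q}`, `p > 0`. -/
def generatingTrivialCofibrations : MorphismProperty (TwistedComplex k) :=
  MorphismProperty.ofHoms (fun q : ℤ => (0 : zero k ⟶ disc k 0 q)) ⊔
  MorphismProperty.ofHoms fun pq : ℕ × ℤ => boundaryInclusion k (pq.1 + 1) pq.2

end TwistedComplex

/-! ### Properties of model categories -/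

namespace HomotopicalAlgebra

universe v w

variable (C : Type w) [Category.{v} C] [ModelCategory C]

/-- The two strengthenings of the axioms of a (closed) model category that are part of many
definitions: all small limits and colimits exist, and the factorizations can be chosen
functorially. -/
structure IsBicompleteWithFunctorialFactorizations : Prop where
  hasLimits : HasLimitsOfSize.{v, v} C
  hasColimits : HasColimitsOfSize.{v, v} C
  cofibration_trivialFibration :
    MorphismProperty.HasFunctorialFactorization (cofibrations C) (trivialFibrations C)
  trivialCofibration_fibration :
    MorphismProperty.HasFunctorialFactorization (trivialCofibrations C) (fibrations C)

/-- Left and right properness. -/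
structure IsProper : Prop where
  /-- weak equivalences are stable under pushout along cofibrations -/
  left {X Y Z T : C} {f : X ⟶ Y} {g : X ⟶ Z} {f' : Y ⟶ T} {g' : Z ⟶ T} :
    IsPushout f g f' g' → Cofibration f → WeakEquivalence g → WeakEquivalence f'
  /-- weak equivalences are stable under pullback along fibrations -/
  right {X Y Z T : C} {f' : X ⟶ Y} {g' : X ⟶ Z} {f : Y ⟶ T} {g : Z ⟶ T} :
    IsPullback f' g' f g → Fibration g → WeakEquivalence f → WeakEquivalence g'

variable {C} in
/-- The model structure is generated by `I` and `J`: the trivial fibrations (resp. fibrations) are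
the maps with the right lifting property with respect to `I` (resp. `J`). -/
structure IsGeneratedBy (I J : MorphismProperty C) : Prop where
  trivialFibrations_eq : trivialFibrations C = I.rlp
  fibrations_eq : fibrations C = J.rlp

/-- Combinatorial model categories: locally presentable and cofibrantly generated. (In a locally
presentable category every object is small, so the generating sets permit the small object
argument.) -/
structure IsCombinatorial : Prop where
  isLocallyPresentable : IsLocallyPresentable.{v} C
  isCofibrantlyGenerated : ∃ I J : MorphismProperty C,
    MorphismProperty.IsSmall.{v} I ∧ MorphismProperty.IsSmall.{v} J ∧ IsGeneratedBy I J

/-- Abelian model categories: the category is abelian, (trivial) cofibrations are the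
monomorphisms with (trivially) cofibrant cokernel, and (trivial) fibrations are the epimorphisms
with (trivially) fibrant kernel. -/
structure IsAbelianModelCategory [Preadditive C] : Prop where
  isAbelian : ∃ A : Abelian C, A.toPreadditive = (inferInstance : Preadditive C)
  cofibration_iff {X Y : C} (f : X ⟶ Y) :
    Cofibration f ↔ Mono f ∧ IsCofibrant (cokernel f)
  trivialCofibration_iff {X Y : C} (f : X ⟶ Y) :
    (Cofibration f ∧ WeakEquivalence f) ↔
      Mono f ∧ IsCofibrant (cokernel f) ∧ WeakEquivalence (initial.to (cokernel f))
  fibration_iff {X Y : C} (f : X ⟶ Y) :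
    Fibration f ↔ Epi f ∧ IsFibrant (kernel f)
  trivialFibration_iff {X Y : C} (f : X ⟶ Y) :
    (Fibration f ∧ WeakEquivalence f) ↔
      Epi f ∧ IsFibrant (kernel f) ∧ WeakEquivalence (terminal.from (kernel f))

end HomotopicalAlgebra

end

/-! Fibrations are defined as `J.rlp`, cofibrations as `I.rlp.llp`, weak equivalences through `Tot`.
Discs corepresent evaluation in a bidegree and boundaries corepresent vertical cycles. Hence `I.rlp`
(resp. `J.rlp`) consists of the epimorphisms whose kernel has acyclic columns for `p ≥ 0` (resp. `p
> 0`). Discs and boundaries are finitely presentable, so the small object argument applies to both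
sets.

The first compatibility, that `I.rlp` is the class of fibrations that are weak equivalences, comes
from the column filtration (`generatingCofibrations_rlp_iff_quasiIso`). The operators `d_i`, `i >
0`, lower the column and every element of `Tot` has a top column, so classes can be removed one
column at a time. If all columns are acyclic, then so is `Tot`. If the columns `p > 0` and `Tot` are
acyclic, then so is column zero.

The second compatibility is that a map in `J.rlp.llp` is a quasi-isomorphism on `Tot`. It rests on
two constructions of fibrations.

(1) The cofree twisted complex on a module `N` consists of pairs of functions on words in `d_1, d_2,
…`, with `d_0` built like a cone, so it is vertically contractible. Every family of linear maps
`A_{p,q} → N` extends to a map from `A` into it, and a surjection `N → N'` induces a map in `I.rlp`.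
Lifting against `N → 0` shows that cofibrations are injective. Lifting against a free module mapping
onto `N` shows that cofibrant objects are projective in each bidegree.

(2) The path object of `A` is `A` with a shifted copy of `Tot A` added in column zero. Its
projection to `A` is a fibration, because the kernel lives in column zero. A section of it is
exactly what yields a contracting homotopy of `Tot A`. Thus `Tot A` is acyclic if `0 ⟶ A` lies in
`J.rlp.llp`. A general map in `J.rlp.llp` is injective by (1), and it is handled through its
cokernel.

A retract argument then identifies the trivial cofibrations with `J.rlp.llp`. For the abelian
conditions, a monomorphism with cofibrant cokernel is shown to be a retract of a cofibration.
Properness reduces, after a factorization, to pulling back a monomorphism along an epimorphism, or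
pushing out an epimorphism along a monomorphism. These operations do not change the cokernel,
respectively the kernel. -/

noncomputable section

namespace TwistedComplex

variable {k : Type u} [CommRing k]

/-! ### Pointwise limits and colimits -/

variable (k) in
/-- Evaluation in bidegree `(p, q)`. -/
def eval (p q : ℤ) : TwistedComplex k ⥤ ModuleCat.{u} k where
  obj A := A.X p q
  map F := F.f p q

scoped instance (p q : ℤ) : (eval k p q).Additive where
  map_add := rfl

section Limits

variable {J : Type*} [Category* J] (F : J ⥤ TwistedComplex k)

/-- A cone which is a limit cone in every bidegree is a limit cone. -/
def isLimitOfEval (s : Cone F) (hs : ∀ p q, IsLimit ((eval k p q).mapCone s)) : IsLimit s :=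
  have ext (p q : ℤ) {W : ModuleCat.{u} k} (a b : W ⟶ s.pt.X p q)
      (h : ∀ j, a ≫ (s.π.app j).f p q = b ≫ (s.π.app j).f p q) : a = b := (hs p q).hom_ext h
  let l (t : Cone F) (p q : ℤ) : t.pt.X p q ⟶ s.pt.X p q := (hs p q).lift ((eval k p q).mapCone t)
  have fac (t : Cone F) (p q : ℤ) (j : J) : l t p q ≫ (s.π.app j).f p q = (t.π.app j).f p q :=
    (hs p q).fac ((eval k p q).mapCone t) j
  { lift t :=
      { f := l t
        comm := fun i p q p' q' => ext _ _ _ _ fun j => by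
          have hs : (s.π.app j).f p q ≫ (F.obj j).d i p q p' q' =
            s.pt.d i p q p' q' ≫ (s.π.app j).f p' q' := (s.π.app j).comm i p q p' q'
          rw [Category.assoc, Category.assoc, fac, ← hs, ← Category.assoc, fac]
          exact (t.π.app j).comm i p q p' q' }
    fac t j := hom_ext fun p q => fac t p q j
    uniq t m hm := hom_ext fun p q => ext _ _ _ _ fun j =>
      (congrArg (fun G : t.pt ⟶ F.obj j => G.f p q) (hm j)).trans (fac t p q j).symm }

/-- A cocone which is a colimit cocone in every bidegree is a colimit cocone. -/
def isColimitOfEval (s : Cocone F) (hs : ∀ p q, IsColimit ((eval k p q).mapCocone s)) :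
    IsColimit s :=
  have ext (p q : ℤ) {W : ModuleCat.{u} k} (a b : s.pt.X p q ⟶ W)
      (h : ∀ j, (s.ι.app j).f p q ≫ a = (s.ι.app j).f p q ≫ b) : a = b := (hs p q).hom_ext h
  let l (t : Cocone F) (p q : ℤ) : s.pt.X p q ⟶ t.pt.X p q :=
    (hs p q).desc ((eval k p q).mapCocone t)
  have fac (t : Cocone F) (p q : ℤ) (j : J) : (s.ι.app j).f p q ≫ l t p q = (t.ι.app j).f p q :=
    (hs p q).fac ((eval k p q).mapCocone t) j
  { desc t :=
      { f := l t
        comm := fun i p q p' q' => ext _ _ _ _ fun j => by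
          have hs : (s.ι.app j).f p q ≫ s.pt.d i p q p' q' =
            (F.obj j).d i p q p' q' ≫ (s.ι.app j).f p' q' := (s.ι.app j).comm i p q p' q'
          rw [← Category.assoc, ← Category.assoc, fac, hs, Category.assoc, fac]
          exact (t.ι.app j).comm i p q p' q' }
    fac t j := hom_ext fun p q => fac t p q j
    uniq t m hm := hom_ext fun p q => ext _ _ _ _ fun j =>
      (congrArg (fun G : F.obj j ⟶ t.pt => G.f p q) (hm j)).trans (fac t p q j).symm }

/-- The natural transformation given by `d_i`. -/
def dNatTrans (i : ℕ) (p q p' q' : ℤ) : eval k p q ⟶ eval k p' q' where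
  app A := A.d i p q p' q'
  naturality _ _ F := F.comm i p q p' q'

section

variable [∀ p q, HasLimit (F ⋙ eval k p q)]

/-- The projections from the pointwise limit. -/
def pointwiseLimitπ (j : J) (p q : ℤ) : limit (F ⋙ eval k p q) ⟶ (F.obj j).X p q :=
  limit.π (F ⋙ eval k p q) j

variable {F} in
theorem pointwiseLimit_ext {p q : ℤ} {W : ModuleCat.{u} k} {a b : W ⟶ limit (F ⋙ eval k p q)}
    (h : ∀ j, a ≫ pointwiseLimitπ F j p q = b ≫ pointwiseLimitπ F j p q) : a = b :=
  limit.hom_ext h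

/-- The maps `d_i` on the pointwise limit. -/
def pointwiseLimitD (i : ℕ) (p q p' q' : ℤ) :
    limit (F ⋙ eval k p q) ⟶ limit (F ⋙ eval k p' q') :=
  limMap (Functor.whiskerLeft F (dNatTrans i p q p' q'))

theorem pointwiseLimitD_π (j : J) (i : ℕ) (p q p' q' : ℤ) :
    pointwiseLimitD F i p q p' q' ≫ pointwiseLimitπ F j p' q' =
      pointwiseLimitπ F j p q ≫ (F.obj j).d i p q p' q' :=
  limMap_π _ _

/-- The pointwise limit. -/
def pointwiseLimit : TwistedComplex k where
  X p q := limit (F ⋙ eval k p q)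
  d := pointwiseLimitD F
  isZero_of_neg p q hp := by
    rw [IsZero.iff_id_eq_zero]
    exact pointwiseLimit_ext fun j => ((F.obj j).isZero_of_neg p q hp).eq_of_tgt _ _
  shape i p q p' q' h := pointwiseLimit_ext fun j => by
    rw [pointwiseLimitD_π, (F.obj j).shape i p q p' q' h, comp_zero, zero_comp]
  sum_d_comp_d n p q p'' q'' := pointwiseLimit_ext fun j => by
    have h := congrArg (pointwiseLimitπ F j p q ≫ ·) ((F.obj j).sum_d_comp_d n p q p'' q'')
    simp only [Preadditive.comp_sum, comp_zero] at h
    rw [zero_comp, Preadditive.sum_comp, ← h]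
    refine Finset.sum_congr rfl fun ij _ => ?_
    rw [Category.assoc, pointwiseLimitD_π, ← Category.assoc, pointwiseLimitD_π, Category.assoc]

/-- The cone over the pointwise limit. -/
def pointwiseCone : Cone F where
  pt := pointwiseLimit F
  π :=
    { app := fun j =>
        { f := pointwiseLimitπ F j
          comm := fun i p q p' q' => (pointwiseLimitD_π F j i p q p' q').symm }
      naturality := fun _ _ φ => hom_ext fun p q =>
        (Category.id_comp _).trans (limit.w (F ⋙ eval k p q) φ).symm }

end

section

variable [∀ p q, HasColimit (F ⋙ eval k p q)]

/-- The inclusions into the pointwise colimit. -/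
def pointwiseColimitι (j : J) (p q : ℤ) : (F.obj j).X p q ⟶ colimit (F ⋙ eval k p q) :=
  colimit.ι (F ⋙ eval k p q) j

variable {F} in
theorem pointwiseColimit_ext {p q : ℤ} {W : ModuleCat.{u} k}
    {a b : colimit (F ⋙ eval k p q) ⟶ W}
    (h : ∀ j, pointwiseColimitι F j p q ≫ a = pointwiseColimitι F j p q ≫ b) : a = b :=
  colimit.hom_ext h

/-- The maps `d_i` on the pointwise colimit. -/
def pointwiseColimitD (i : ℕ) (p q p' q' : ℤ) :
    colimit (F ⋙ eval k p q) ⟶ colimit (F ⋙ eval k p' q') :=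
  colimMap (Functor.whiskerLeft F (dNatTrans i p q p' q'))

theorem pointwiseColimitι_d (j : J) (i : ℕ) (p q p' q' : ℤ) :
    pointwiseColimitι F j p q ≫ pointwiseColimitD F i p q p' q' =
      (F.obj j).d i p q p' q' ≫ pointwiseColimitι F j p' q' :=
  ι_colimMap _ _

/-- The pointwise colimit. -/
def pointwiseColimit : TwistedComplex k where
  X p q := colimit (F ⋙ eval k p q)
  d := pointwiseColimitD F
  isZero_of_neg p q hp := by
    rw [IsZero.iff_id_eq_zero]
    exact pointwiseColimit_ext fun j => ((F.obj j).isZero_of_neg p q hp).eq_of_src _ _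
  shape i p q p' q' h := pointwiseColimit_ext fun j => by
    rw [pointwiseColimitι_d, (F.obj j).shape i p q p' q' h, comp_zero, zero_comp]
  sum_d_comp_d n p q p'' q'' := pointwiseColimit_ext fun j => by
    have h := congrArg (· ≫ pointwiseColimitι F j p'' q'')
      ((F.obj j).sum_d_comp_d n p q p'' q'')
    simp only [Preadditive.sum_comp, zero_comp] at h
    rw [comp_zero, Preadditive.comp_sum, ← h]
    refine Finset.sum_congr rfl fun ij _ => ?_
    rw [← Category.assoc, pointwiseColimitι_d, Category.assoc, pointwiseColimitι_d, Category.assoc]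

/-- The cocone under the pointwise colimit. -/
def pointwiseCocone : Cocone F where
  pt := pointwiseColimit F
  ι :=
    { app := fun j =>
        { f := pointwiseColimitι F j
          comm := fun i p q p' q' => pointwiseColimitι_d F j i p q p' q' }
      naturality := fun _ _ φ => hom_ext fun p q =>
        (colimit.w (F ⋙ eval k p q) φ).trans (Category.comp_id _).symm }

end

/-- The pointwise limit is a limit. -/
def isLimitPointwiseCone [∀ p q, HasLimit (F ⋙ eval k p q)] : IsLimit (pointwiseCone F) :=
  isLimitOfEval _ _ fun _ _ => limit.isLimit _

/-- The pointwise colimit is a colimit. -/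
def isColimitPointwiseCocone [∀ p q, HasColimit (F ⋙ eval k p q)] :
    IsColimit (pointwiseCocone F) :=
  isColimitOfEval _ _ fun _ _ => colimit.isColimit _

scoped instance [∀ p q, HasLimit (F ⋙ eval k p q)] : HasLimit F := ⟨⟨⟨_, isLimitPointwiseCone F⟩⟩⟩

scoped instance [∀ p q, HasColimit (F ⋙ eval k p q)] : HasColimit F :=
  ⟨⟨⟨_, isColimitPointwiseCocone F⟩⟩⟩

scoped instance [∀ p q, HasLimit (F ⋙ eval k p q)] (p q : ℤ) : PreservesLimit F (eval k p q) :=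
  preservesLimit_of_preserves_limit_cone (isLimitPointwiseCone F) (limit.isLimit _)

scoped instance [∀ p q, HasColimit (F ⋙ eval k p q)] (p q : ℤ) : PreservesColimit F (eval k p q) :=
  preservesColimit_of_preserves_colimit_cocone (isColimitPointwiseCocone F) (colimit.isColimit _)

end Limits

scoped instance {J : Type*} [Category* J] [HasLimitsOfShape J (ModuleCat.{u} k)] :
    HasLimitsOfShape J (TwistedComplex k) := ⟨inferInstance⟩

scoped instance {J : Type*} [Category* J] [HasColimitsOfShape J (ModuleCat.{u} k)] :
    HasColimitsOfShape J (TwistedComplex k) := ⟨inferInstance⟩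

scoped instance : HasLimitsOfSize.{u, u} (TwistedComplex k) := ⟨inferInstance⟩

scoped instance : HasColimitsOfSize.{u, u} (TwistedComplex k) := ⟨inferInstance⟩

scoped instance (p q : ℤ) : PreservesColimitsOfSize.{u, u} (eval k p q) := ⟨⟨inferInstance⟩⟩

scoped instance : HasFiniteLimits (TwistedComplex k) := ⟨inferInstance⟩

scoped instance : HasFiniteColimits (TwistedComplex k) := ⟨inferInstance⟩

scoped instance (p q : ℤ) : PreservesFiniteLimits (eval k p q) := ⟨fun _ _ _ => ⟨inferInstance⟩⟩

scoped instance (p q : ℤ) : PreservesFiniteColimits (eval k p q) := ⟨fun _ _ _ => ⟨inferInstance⟩⟩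

/-! ### The abelian category of twisted complexes -/

variable {A B : TwistedComplex k}

theorem isIso_of_isIso_f (F : A ⟶ B) [∀ p q, IsIso (F.f p q)] : IsIso F :=
  ⟨⟨{ f := fun p q => inv (F.f p q)
      comm := fun i p q p' q' => by
        rw [IsIso.inv_comp_eq, ← Category.assoc, IsIso.eq_comp_inv, F.comm] },
    hom_ext fun p q => by simp, hom_ext fun p q => by simp⟩⟩

theorem mono_iff_injective (F : A ⟶ B) :
    Mono F ↔ ∀ p q, Function.Injective (F.f p q) := by
  refine ⟨fun _ p q => (ModuleCat.mono_iff_injective _).1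
    (inferInstanceAs (Mono ((eval k p q).map F))), fun h => ⟨fun G H e => hom_ext fun p q => ?_⟩⟩
  have := (ModuleCat.mono_iff_injective (F.f p q)).2 (h p q)
  rw [← cancel_mono (F.f p q)]
  exact congrArg (fun G : _ ⟶ B => G.f p q) e

theorem epi_iff_surjective (F : A ⟶ B) :
    Epi F ↔ ∀ p q, Function.Surjective (F.f p q) := by
  refine ⟨fun _ p q => (ModuleCat.epi_iff_surjective _).1
    (inferInstanceAs (Epi ((eval k p q).map F))), fun h => ⟨fun G H e => hom_ext fun p q => ?_⟩⟩
  have := (ModuleCat.epi_iff_surjective (F.f p q)).2 (h p q)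
  rw [← cancel_epi (F.f p q)]
  exact congrArg (fun G : A ⟶ _ => G.f p q) e

scoped instance (F : A ⟶ B) [Mono F] (p q : ℤ) : Mono (F.f p q) :=
  inferInstanceAs (Mono ((eval k p q).map F))

-- Kernels and cokernels are computed in each bidegree, so normality of epimorphisms, and likewise
-- of monomorphisms, is inherited from modules.
scoped instance : IsNormalEpiCategory (TwistedComplex k) := ⟨fun F _ =>
  ⟨NormalEpi.mk _ (kernel.ι F) (kernel.condition _)
    (isColimitOfEval _ _ fun p q =>
      have : Epi ((eval k p q).map F) := inferInstance
      Abelian.isColimitMapCoconeOfCokernelCoforkOfπ F (eval k p q))⟩⟩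

scoped instance : IsNormalMonoCategory (TwistedComplex k) := ⟨fun F _ =>
  ⟨NormalMono.mk _ (cokernel.π F) (cokernel.condition _)
    (isLimitOfEval _ _ fun p q =>
      have : Mono ((eval k p q).map F) := inferInstance
      Abelian.isLimitMapConeOfKernelForkOfι F (eval k p q))⟩⟩

scoped instance : Abelian (TwistedComplex k) where

theorem kernel_ι_injective (F : A ⟶ B) (p q : ℤ) :
    Function.Injective ((kernel.ι F).f p q) :=
  (mono_iff_injective _).1 inferInstance p q

theorem exact_f {S : ShortComplex (TwistedComplex k)} (hS : S.Exact) (p q : ℤ) :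
    Function.Exact (S.f.f p q) (S.g.f p q) := by
  have := hS.map (eval k p q)
  exact (ShortComplex.ShortExact.moduleCat_exact_iff_function_exact _).1 this

theorem exact_kernel_ι (F : A ⟶ B) (p q : ℤ) :
    Function.Exact ((kernel.ι F).f p q) (F.f p q) :=
  exact_f (S := ShortComplex.mk _ _ (kernel.condition F)) (ShortComplex.exact_kernel F) p q

theorem shortExact_kernel (F : A ⟶ B) [Epi F] :
    (ShortComplex.mk _ _ (kernel.condition F)).ShortExact :=
  { exact := ShortComplex.exact_kernel F }

theorem shortExact_cokernel (F : A ⟶ B) [Mono F] :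
    (ShortComplex.mk _ _ (cokernel.condition F)).ShortExact :=
  { exact := ShortComplex.exact_cokernel F }

end TwistedComplex

namespace TwistedComplex

variable {k : Type u} [CommRing k]

/-! ### The universal property of cyclic twisted complexes -/

theorem comm_apply {A B : TwistedComplex k} (F : A ⟶ B) (i : ℕ) (p q p' q' : ℤ) (x : A.X p q) :
    B.d i p q p' q' (F.f p q x) = F.f p' q' (A.d i p q p' q' x) :=
  congrArg (fun G => G.hom x) (F.comm i p q p' q')

theorem d_zero_d_zero (A : TwistedComplex k) (p q s t s' t' : ℤ) (x : A.X p q) :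
    A.d 0 s t s' t' (A.d 0 p q s t x) = 0 := by
  by_cases h : s + (0 : ℕ) = p ∧ t + 1 = q + (0 : ℕ)
  · have e := congrArg (fun G => G.hom x) (A.sum_d_comp_d 0 p q s' t')
    rw [Finset.Nat.antidiagonal_zero, Finset.sum_singleton] at e
    have e' := A.d_comp_d_congr (i := 0) (j := 0) (p := p) (q := q) (p'' := s') (q'' := t')
      (show p - ((0 : ℕ) : ℤ) = s by lia) (show q + ((0 : ℕ) : ℤ) - 1 = t by lia)
    rw [e'] at e
    exact e
  · rw [A.shape 0 p q s t h]
    exact map_zero _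

/-- The map `d_{i_1} ⋯ d_{i_n}` from bidegree `(p, q)` to bidegree `(a, b)`, for a word
`[i_1, …, i_n]`. -/
def act (A : TwistedComplex k) (p q : ℤ) : List ℕ → (a b : ℤ) → (A.X p q ⟶ A.X a b)
  | [], a, b => if h : p = a ∧ q = b then eqToHom (by rw [h.1, h.2]) else 0
  | i :: w, a, b => act A p q w (a + i) (b + 1 - i) ≫ A.d i (a + i) (b + 1 - i) a b

theorem act_nil_self (A : TwistedComplex k) (p q : ℤ) : A.act p q [] p q = 𝟙 _ := by
  simp [act]

theorem act_cons (A : TwistedComplex k) (p q : ℤ) (i : ℕ) (w : List ℕ) (a b : ℤ) :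
    A.act p q (i :: w) a b = A.act p q w (a + i) (b + 1 - i) ≫ A.d i (a + i) (b + 1 - i) a b :=
  rfl

theorem act_comp_congr (A : TwistedComplex k) (p q : ℤ) (w : List ℕ) {s t s' t' a b : ℤ}
    (hs : s = s') (ht : t = t') {i : ℕ} :
    A.act p q w s t ≫ A.d i s t a b = A.act p q w s' t' ≫ A.d i s' t' a b := by
  subst hs ht
  rfl

theorem act_eq_zero (A : TwistedComplex k) (p q : ℤ) (w : List ℕ) (a b : ℤ)
    (h : ¬ IsWordOf p q a b w) : A.act p q w a b = 0 := by
  -- Settled before the induction: `IsWordOf` demands `0 ≤ a`, and this persists when `a` is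
  -- replaced by `a + i`.
  by_cases ha : a < 0
  · exact (A.isZero_of_neg a b ha).eq_of_tgt _ _
  rw [not_lt] at ha
  induction w generalizing a b with
  | nil =>
    rw [act, dif_neg]
    rintro ⟨rfl, rfl⟩
    exact h ⟨ha, by simp, by simp⟩
  | cons i w ih =>
    rw [act_cons, ih, zero_comp]
    · intro hw
      refine h ⟨ha, ?_, ?_⟩
      · have := hw.2.1
        simp only [List.sum_cons, Nat.cast_add]
        lia
      · have := hw.2.2
        simp only [List.sum_cons, List.length_cons, Nat.cast_add, Nat.cast_one]
        lia
    · lia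

theorem act_append_eq_zero (A : TwistedComplex k) (p q : ℤ) (g : List ℕ) (x : A.X p q)
    (h : ∀ a b, A.act p q g a b x = 0) (u : List ℕ) (a b : ℤ) :
    A.act p q (u ++ g) a b x = 0 := by
  induction u generalizing a b with
  | nil => exact h a b
  | cons i u ih =>
    rw [List.cons_append, act_cons, ConcreteCategory.comp_apply, ih, map_zero]

theorem sum_act_eq_zero (A : TwistedComplex k) (p q : ℤ) (u v : List ℕ) (m : ℕ) (a b : ℤ) :
    ∑ ij ∈ Finset.HasAntidiagonal.antidiagonal m, A.act p q (u ++ ij.1 :: ij.2 :: v) a b = 0 := by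
  induction u generalizing a b with
  | nil =>
    have h := congrArg (A.act p q v (a + m) (b + 2 - m) ≫ ·)
      (A.sum_d_comp_d m (a + m) (b + 2 - m) a b)
    simp only [Preadditive.comp_sum, comp_zero] at h
    rw [← h]
    refine Finset.sum_congr rfl fun ij hij => ?_
    rw [Finset.HasAntidiagonal.mem_antidiagonal] at hij
    rw [List.nil_append, act_cons, act_cons, Category.assoc,
      A.d_comp_d_congr (show a + m - (ij.2 : ℤ) = a + ij.1 by lia)
        (show b + 2 - m + (ij.2 : ℤ) - 1 = b + 1 - ij.1 by lia),
      ← Category.assoc, ← Category.assoc,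
      A.act_comp_congr p q v (show a + ij.1 + ij.2 = a + m by lia)
        (show b + 1 - ij.1 + 1 - ij.2 = b + 2 - m by lia)]
  | cons i u ih =>
    simp only [List.cons_append, act_cons]
    rw [← Preadditive.sum_comp, ih, zero_comp]

variable (k) in
theorem single_eq_smul_word (w : List ℕ) (c : k) : Finsupp.single w c = c • word k w := by
  simp [word]

/-- The element `w(x)` of bidegree `(a, b)` in the cyclic twisted complex. -/
def cyclicMk (G : Set (List ℕ)) (p q a b : ℤ) (w : List ℕ) : (cyclic k G p q).X a b :=
  Submodule.mkQ (relations k G p q a b) (word k w)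

/-- The generator of the cyclic twisted complex. -/
def cyclicGen (G : Set (List ℕ)) (p q : ℤ) : (cyclic k G p q).X p q := cyclicMk G p q p q []

theorem cyclicMk_eq_zero (G : Set (List ℕ)) (p q a b : ℤ) (w : List ℕ)
    (h : ¬ IsWordOf p q a b w) : cyclicMk (k := k) G p q a b w = 0 := by
  exact (Submodule.Quotient.mk_eq_zero _).2 (Submodule.subset_span (Or.inl (Or.inl ⟨w, h, rfl⟩)))

theorem cyclicMk_eq_zero_of_mem (G : Set (List ℕ)) (p q a b : ℤ) (w : List ℕ)
    (h : w ∈ G) : cyclicMk (k := k) G p q a b w = 0 := by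
  exact (Submodule.Quotient.mk_eq_zero _).2 (Submodule.subset_span (Or.inr ⟨[], w, h, rfl⟩))

theorem cyclic_d_mk (G : Set (List ℕ)) (p q a b a' b' : ℤ) (i : ℕ) (w : List ℕ)
    (h : a' + i = a ∧ b' + 1 = b + i) :
    (cyclic k G p q).d i a b a' b' (cyclicMk G p q a b w) = cyclicMk G p q a' b' (i :: w) := by
  simp only [cyclic, dif_pos h]
  exact congrArg (Submodule.mkQ (relations k G p q a' b')) (consMap_word k i w)

/-- Every word is reached from the generator by applying the `d_i`, with which morphisms commute. -/
theorem cyclic_hom_ext {G : Set (List ℕ)} {p q : ℤ} {A : TwistedComplex k}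
    {F F' : cyclic k G p q ⟶ A}
    (h : F.f p q (cyclicGen G p q) = F'.f p q (cyclicGen G p q)) : F = F' := by
  have key (w : List ℕ) (a b : ℤ) :
      F.f a b (cyclicMk G p q a b w) = F'.f a b (cyclicMk G p q a b w) := by
    induction w generalizing a b with
    | nil =>
      by_cases hw : IsWordOf p q a b []
      · obtain rfl : a = p := by simpa using hw.2.1
        obtain rfl : b = q := by simpa using hw.2.2
        exact h
      · rw [cyclicMk_eq_zero _ _ _ _ _ _ hw, map_zero, map_zero]
    | cons i w ih =>
      rw [← cyclic_d_mk G p q (a + i) (b + 1 - i) a b i w (by lia), ← comm_apply, ← comm_apply, ih]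
  refine hom_ext fun a b => ModuleCat.hom_ext (LinearMap.ext fun x => ?_)
  obtain ⟨x, rfl⟩ := Submodule.mkQ_surjective _ x
  induction x using Finsupp.induction_linear with
  | zero => rw [map_zero]; exact (map_zero (F.f a b).hom).trans (map_zero (F'.f a b).hom).symm
  | add x y hx hy =>
    rw [map_add]
    exact (map_add (F.f a b).hom _ _).trans
      ((congrArg₂ (· + ·) hx hy).trans (map_add (F'.f a b).hom _ _).symm)
  | single w c =>
    rw [single_eq_smul_word, map_smul]
    exact (map_smul (F.f a b).hom _ _).trans
      ((congrArg (c • ·) (key w a b)).trans (map_smul (F'.f a b).hom _ _).symm)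

/-- Each of the three kinds of relations holds for `x` in `A`: words of the wrong bidegree act by
zero, the quadratic relations are those of a twisted complex, and the words in `G` kill `x` by
assumption. This is what lets `cyclicDesc` descend to the quotient. -/
theorem relations_le_ker (G : Set (List ℕ)) (p q : ℤ) {A : TwistedComplex k} (x : A.X p q)
    (hx : ∀ g ∈ G, ∀ a b, A.act p q g a b x = 0) (a b : ℤ) :
    relations k G p q a b ≤
      LinearMap.ker (Finsupp.linearCombination k fun w => A.act p q w a b x) := by
  refine Submodule.span_le.2 ?_
  rintro r ((⟨w, hw, rfl⟩ | ⟨u, v, m, rfl⟩) | ⟨u, g, hg, rfl⟩)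
  · simp [word, act_eq_zero A p q w a b hw]
  · have := congrArg (fun F => F.hom x) (sum_act_eq_zero A p q u v m a b)
    simpa [word, ModuleCat.hom_sum] using this
  · simp [word, act_append_eq_zero A p q g x (hx g hg) u a b]

/-- The map out of a cyclic twisted complex determined by an element satisfying the relations. -/
def cyclicDesc (G : Set (List ℕ)) (p q : ℤ) {A : TwistedComplex k} (x : A.X p q)
    (hx : ∀ g ∈ G, ∀ a b, A.act p q g a b x = 0) : cyclic k G p q ⟶ A where
  f a b := ModuleCat.ofHom (Submodule.liftQ _ _ (relations_le_ker G p q x hx a b))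
  comm i a b a' b' := by
    by_cases h : a' + i = a ∧ b' + 1 = b + i
    · refine ModuleCat.hom_ext (LinearMap.ext fun w => ?_)
      obtain ⟨w, rfl⟩ := Submodule.mkQ_surjective _ w
      simp only [cyclic, dif_pos h]
      change A.d i a b a' b' (Finsupp.linearCombination k (fun w => A.act p q w a b x) w) =
        Finsupp.linearCombination k (fun w => A.act p q w a' b' x) (consMap k i w)
      induction w using Finsupp.induction_linear with
      | zero => simp
      | add x y hx hy => simp only [map_add, hx, hy]
      | single w c =>
        obtain rfl : a = a' + i := h.1.symm
        obtain rfl : b = b' + 1 - i := by lia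
        simp [consMap, act_cons]
    · rw [A.shape _ _ _ _ _ h, (cyclic k G p q).shape _ _ _ _ _ h]
      exact comp_zero.trans zero_comp.symm

theorem cyclicDesc_gen (G : Set (List ℕ)) (p q : ℤ) {A : TwistedComplex k} (x : A.X p q)
    (hx : ∀ g ∈ G, ∀ a b, A.act p q g a b x = 0) :
    (cyclicDesc G p q x hx).f p q (cyclicGen G p q) = x := by
  change Finsupp.linearCombination k (fun w => A.act p q w p q x) (word k []) = x
  simp [word, act_nil_self]

/-- Morphisms out of a disc are elements. -/
def discHomEquiv (p q : ℤ) (A : TwistedComplex k) : (disc k p q ⟶ A) ≃ A.X p q where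
  toFun F := F.f p q (cyclicGen ∅ p q)
  invFun x := cyclicDesc ∅ p q x (by simp)
  left_inv _ := cyclic_hom_ext (cyclicDesc_gen _ _ _ _ _)
  right_inv _ := cyclicDesc_gen _ _ _ _ _

theorem act_zero_eq_zero (A : TwistedComplex k) (p q : ℤ) (x : A.X p q)
    (h : A.d 0 p q p (q - 1) x = 0) (a b : ℤ) : A.act p q [0] a b x = 0 := by
  by_cases hw : IsWordOf p q a b [0]
  · obtain rfl : a = p := by simpa using hw.2.1
    obtain rfl : b = q - 1 := by
      have := hw.2.2
      simp at this
      lia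
    rw [act_cons, A.act_comp_congr a q [] (show a + (0 : ℕ) = a by simp)
      (show q - 1 + 1 - (0 : ℕ) = q by simp), act_nil_self, Category.id_comp, h]
  · rw [act_eq_zero A p q _ a b hw]
    rfl

/-- Morphisms out of a vertical boundary are vertical cycles. -/
def boundaryDesc (p q : ℤ) {A : TwistedComplex k} (y : A.X p (q - 1))
    (hy : A.d 0 p (q - 1) p (q - 1 - 1) y = 0) : boundary k p q ⟶ A :=
  cyclicDesc {[0]} p (q - 1) y (by
    rintro _ rfl
    exact act_zero_eq_zero A p (q - 1) y hy)

theorem boundaryDesc_gen (p q : ℤ) {A : TwistedComplex k} (y : A.X p (q - 1))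
    (hy : A.d 0 p (q - 1) p (q - 1 - 1) y = 0) :
    (boundaryDesc p q y hy).f p (q - 1) (cyclicGen {[0]} p (q - 1)) = y :=
  cyclicDesc_gen _ _ _ _ _

theorem d_zero_boundary_gen (p q : ℤ) :
    (boundary k p q).d 0 p (q - 1) p (q - 1 - 1) (cyclicGen {[0]} p (q - 1)) = 0 :=
  (cyclic_d_mk {[0]} p (q - 1) p (q - 1) p (q - 1 - 1) 0 [] (by simp)).trans
    (cyclicMk_eq_zero_of_mem _ _ _ _ _ _ rfl)

theorem boundaryInclusion_gen (p q : ℤ) :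
    (boundaryInclusion k p q).f p (q - 1) (cyclicGen {[0]} p (q - 1)) =
      (disc k p q).d 0 p q p (q - 1) (cyclicGen ∅ p q) := by
  refine Eq.trans ?_ (cyclic_d_mk ∅ p q p q p (q - 1) 0 [] (by simp)).symm
  exact congrArg (Submodule.mkQ (relations k ∅ p q p (q - 1))) (snocZeroMap_word k [])

/-! ### Local presentability -/

open Opposite

attribute [local instance] Cardinal.fact_isRegular_aleph0 Cardinal.orderBotAleph0OrdToType

variable (k) in
/-- The disc corepresents the evaluation. -/
def coyonedaDiscIso (p q : ℤ) :
    coyoneda.obj (op (disc k p q)) ≅ eval k p q ⋙ forget (ModuleCat.{u} k) :=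
  NatIso.ofComponents (fun A => (discHomEquiv p q A).toIso) (fun _ => rfl)

-- The functor corepresented by a disc is evaluation followed by the forgetful functor, and both
-- preserve filtered colimits.
scoped instance (p q : ℤ) : IsFinitelyPresentable.{u} (disc k p q) := by
  rw [isFinitelyPresentable_iff_preservesFilteredColimits]
  refine ⟨fun J _ _ => ?_⟩
  exact preservesColimitsOfShape_of_natIso (coyonedaDiscIso k p q).symm

variable (k) in
/-- The map from a disc to the disc containing its boundary. -/
def discMap (p q : ℤ) : disc k p (q - 1) ⟶ disc k p q :=
  (discHomEquiv p (q - 1) _).symm ((disc k p q).d 0 p q p (q - 1) (cyclicGen ∅ p q))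

variable (k) in
/-- The projection from a disc to the cyclic twisted complex with the same generator. -/
def discToBoundary (p q : ℤ) : disc k p (q - 1) ⟶ boundary k p q :=
  (discHomEquiv p (q - 1) _).symm (cyclicGen {[0]} p (q - 1))

theorem discMap_gen (p q : ℤ) : (discMap k p q).f p (q - 1) (cyclicGen ∅ p (q - 1)) =
    (disc k p q).d 0 p q p (q - 1) (cyclicGen ∅ p q) :=
  (discHomEquiv p (q - 1) _).apply_symm_apply _

theorem discToBoundary_gen (p q : ℤ) :
    (discToBoundary k p q).f p (q - 1) (cyclicGen ∅ p (q - 1)) = cyclicGen {[0]} p (q - 1) :=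
  (discHomEquiv p (q - 1) _).apply_symm_apply _

theorem discMap_discToBoundary (p q : ℤ) :
    discMap k p (q - 1) ≫ discToBoundary k p q = 0 := by
  refine cyclic_hom_ext ?_
  refine (congrArg _ (discMap_gen p (q - 1))).trans ?_
  refine (comm_apply (discToBoundary k p q) _ _ _ _ _ _).symm.trans ?_
  rw [discToBoundary_gen]
  exact d_zero_boundary_gen p q

theorem d_zero_eq_zero_of_discMap_comp (p q : ℤ) {A : TwistedComplex k} (g : disc k p q ⟶ A)
    (hg : discMap k p q ≫ g = 0) : A.d 0 p q p (q - 1) (discHomEquiv p q A g) = 0 := by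
  have h := congrArg (fun F => F.f p (q - 1) (cyclicGen ∅ p (q - 1))) hg
  refine ((comm_apply g _ _ _ _ _ _).trans ?_).trans h
  exact congrArg _ (discMap_gen p q).symm

variable (k) in
/-- The vertical boundary is the cokernel of a map of discs. -/
def boundaryIsCokernel (p q : ℤ) :
    IsColimit (CokernelCofork.ofπ (discToBoundary k p q) (discMap_discToBoundary p q)) :=
  CokernelCofork.IsColimit.ofπ _ _
    (fun g hg => boundaryDesc p q _ (d_zero_eq_zero_of_discMap_comp p (q - 1) g hg))
    (fun g hg => cyclic_hom_ext ((congrArg _ (discToBoundary_gen p q)).trans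
      (boundaryDesc_gen p q _ (d_zero_eq_zero_of_discMap_comp p (q - 1) g hg))))
    (fun g hg m hm => cyclic_hom_ext (by
      refine Eq.trans ?_
        (boundaryDesc_gen p q _ (d_zero_eq_zero_of_discMap_comp p (q - 1) g hg)).symm
      rw [← hm, ← discToBoundary_gen]
      rfl))

scoped instance (p q : ℤ) : IsFinitelyPresentable.{u} (boundary k p q) := by
  have : ∀ j, IsCardinalPresentable ((parallelPair (discMap k p (q - 1)) 0).obj j)
      Cardinal.aleph0.{u} := by
    rintro (_ | _)
    · exact inferInstanceAs (IsFinitelyPresentable.{u} (disc k p (q - 1 - 1)))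
    · exact inferInstanceAs (IsFinitelyPresentable.{u} (disc k p (q - 1)))
  exact isCardinalPresentable_of_isColimit.{u} _ (boundaryIsCokernel k p q) _
    (by rw [hasCardinalLT_aleph0_iff]; infer_instance)

variable (k) in
theorem isZero_zero : IsZero (zero k) := by
  rw [IsZero.iff_id_eq_zero]
  exact hom_ext fun p q => (ModuleCat.isZero_of_subsingleton (ModuleCat.of k PUnit)).eq_of_src _ _

scoped instance : IsFinitelyPresentable.{u} (zero k) :=
  Retract.isCardinalPresentable (X := disc k 0 0)
    { i := 0
      r := 0
      retract := (isZero_zero k).eq_of_src _ _ } _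

variable (k) in
/-- The discs. -/
def discs : ObjectProperty (TwistedComplex k) :=
  ObjectProperty.ofObj fun pq : ℤ × ℤ => disc k pq.1 pq.2

scoped instance : ObjectProperty.Small.{u} (discs k) := by
  unfold discs
  infer_instance

/-- Maps out of discs are elements, so they separate morphisms, and a monomorphism through which all
of them factor is bijective in every bidegree. -/
theorem discs_isStrongGenerator : (discs k).IsStrongGenerator := by
  rw [ObjectProperty.isStrongGenerator_iff]
  refine ⟨fun A B F F' h => hom_ext fun p q => ModuleCat.hom_ext (LinearMap.ext fun x => ?_),
    fun A B F _ h => ?_⟩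
  · have e := h (disc k p q) (ObjectProperty.ofObj_apply _ (p, q)) ((discHomEquiv p q A).symm x)
    have e' := congrArg (discHomEquiv p q B) e
    have hx := (discHomEquiv p q A).apply_symm_apply x
    change F.f p q x = F'.f p q x
    rw [← hx]
    exact e'
  · have : ∀ p q, IsIso (F.f p q) := fun p q => by
      have : Epi (F.f p q) := (ModuleCat.epi_iff_surjective _).2 fun y => by
        obtain ⟨G, hG⟩ := h (disc k p q) (ObjectProperty.ofObj_apply _ (p, q))
          ((discHomEquiv p q B).symm y)
        refine ⟨discHomEquiv p q A G, ?_⟩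
        rw [← (discHomEquiv p q B).apply_symm_apply y, ← hG]
        rfl
      exact isIso_of_mono_of_epi _
    exact isIso_of_isIso_f F

scoped instance : IsCardinalLocallyPresentable.{u} (TwistedComplex k) Cardinal.aleph0.{u} := by
  rw [IsCardinalLocallyPresentable.iff_exists_isStrongGenerator]
  refine ⟨discs k, inferInstance, discs_isStrongGenerator, ?_⟩
  rintro _ ⟨p, q⟩
  exact inferInstanceAs (IsFinitelyPresentable.{u} (disc k p q))

scoped instance : IsLocallyPresentable.{u} (TwistedComplex k) :=
  ⟨⟨Cardinal.aleph0, inferInstance, inferInstance⟩⟩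

-- Smallness of the generating sets and the small object argument

scoped instance : MorphismProperty.IsSmall.{u} (generatingCofibrations k) := by
  unfold generatingCofibrations
  exact MorphismProperty.isSmall_ofHoms _

scoped instance : MorphismProperty.IsSmall.{u} (generatingTrivialCofibrations k) := by
  unfold generatingTrivialCofibrations
  -- The binary join is rewritten as a join over `Bool`, the form to which `isSmall_iSup` applies.
  rw [sup_eq_iSup]
  have (b : Bool) : MorphismProperty.IsSmall.{u}
      (cond b (MorphismProperty.ofHoms (fun q : ℤ => (0 : zero k ⟶ disc k 0 q)))
        (MorphismProperty.ofHoms fun pq : ℕ × ℤ => boundaryInclusion k (pq.1 + 1) pq.2)) := by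
    cases b
    all_goals exact MorphismProperty.isSmall_ofHoms _
  exact MorphismProperty.isSmall_iSup _

theorem isFinitelyPresentable_of_generatingCofibrations {A B : TwistedComplex k} {F : A ⟶ B}
    (h : generatingCofibrations k F) : IsFinitelyPresentable.{u} A := by
  obtain ⟨p, q⟩ := h
  infer_instance

theorem isFinitelyPresentable_of_generatingTrivialCofibrations {A B : TwistedComplex k}
    {F : A ⟶ B} (h : generatingTrivialCofibrations k F) : IsFinitelyPresentable.{u} A := by
  obtain ⟨⟨q⟩⟩ | ⟨⟨p, q⟩⟩ := h
  all_goals infer_instance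

scoped instance : MorphismProperty.IsCardinalForSmallObjectArgument (generatingCofibrations k)
    Cardinal.aleph0.{u} where
  preservesColimit i hi f hf := by
    have := isFinitelyPresentable_of_generatingCofibrations hi
    infer_instance

scoped instance : MorphismProperty.IsCardinalForSmallObjectArgument
    (generatingTrivialCofibrations k) Cardinal.aleph0.{u} where
  preservesColimit i hi f hf := by
    have := isFinitelyPresentable_of_generatingTrivialCofibrations hi
    infer_instance

scoped instance : MorphismProperty.HasSmallObjectArgument.{u} (generatingCofibrations k) :=
  ⟨.aleph0, inferInstance, inferInstance, inferInstance⟩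

scoped instance : MorphismProperty.HasSmallObjectArgument.{u} (generatingTrivialCofibrations k) :=
  ⟨.aleph0, inferInstance, inferInstance, inferInstance⟩

end TwistedComplex

/-! ### Short exact sequences of complexes and quasi-isomorphisms -/

namespace HomologicalComplex

universe v w

variable {C : Type w} [Category.{v} C] [Abelian C] {ι : Type*} {c : ComplexShape ι}
  {S : ShortComplex (HomologicalComplex C c)}

/-- The long exact homology sequence, in which the homology of the first term vanishes. -/
theorem quasiIso_g_of_acyclic (hS : S.ShortExact) (h : S.X₁.Acyclic) : QuasiIso S.g := by
  have h₀ (i : ι) : IsZero (S.X₁.homology i) := (exactAt_iff_isZero_homology _ _).1 (h i)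
  rw [quasiIso_iff]
  intro i
  rw [quasiIsoAt_iff_isIso_homologyMap]
  have : Mono (homologyMap S.g i) := by
    rw [Preadditive.mono_iff_cancel_zero]
    intro T f hf
    have := (hS.homology_exact₂ i).mono_g ((h₀ i).eq_of_src _ _)
    exact (cancel_mono (homologyMap S.g i)).1 (hf.trans zero_comp.symm)
  have : Epi (homologyMap S.g i) := by
    -- For a general complex shape the connecting map out of degree `i` exists only if `i` has a
    -- successor; otherwise an epimorphism of complexes is already epi on homology there.
    by_cases! hi : ∃ j, c.Rel i j
    · obtain ⟨j, hij⟩ := hi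
      exact (hS.homology_exact₃ i j hij).epi_f ((h₀ j).eq_of_tgt _ _)
    · have := hS.epi_g
      exact epi_homologyMap_of_epi_of_not_rel S.g i hi
  exact isIso_of_mono_of_epi _

theorem quasiIso_f_of_acyclic (hS : S.ShortExact) (h : S.X₃.Acyclic) : QuasiIso S.f := by
  have h₀ (i : ι) : IsZero (S.X₃.homology i) := (exactAt_iff_isZero_homology _ _).1 (h i)
  rw [quasiIso_iff]
  intro i
  rw [quasiIsoAt_iff_isIso_homologyMap]
  have : Epi (homologyMap S.f i) := (hS.homology_exact₂ i).epi_f ((h₀ i).eq_of_tgt _ _)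
  have : Mono (homologyMap S.f i) := by
    by_cases! hi : ∃ j, c.Rel j i
    · obtain ⟨j, hij⟩ := hi
      exact (hS.homology_exact₁ j i hij).mono_g ((h₀ j).eq_of_src _ _)
    · have := hS.mono_f
      exact mono_homologyMap_of_mono_of_not_rel S.f i hi
  exact isIso_of_mono_of_epi _

theorem quasiIso_g_iff (hS : S.ShortExact) : QuasiIso S.g ↔ S.X₁.Acyclic :=
  ⟨hS.acyclic_X₁, quasiIso_g_of_acyclic hS⟩

theorem quasiIso_f_iff (hS : S.ShortExact) : QuasiIso S.f ↔ S.X₃.Acyclic :=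
  ⟨hS.acyclic_X₃, quasiIso_f_of_acyclic hS⟩

end HomologicalComplex

theorem ChainComplex.acyclic_iff {k : Type u} [CommRing k] (K : ChainComplex (ModuleCat.{u} k) ℤ) :
    K.Acyclic ↔ ∀ (i j l : ℤ), j + 1 = i → l + 1 = j → ∀ z : K.X j, K.d j l z = 0 →
      ∃ w : K.X i, K.d i j w = z := by
  constructor
  · rintro h i j l hi hl z hz
    have := h j
    rw [K.exactAt_iff' i j l (by simp [← hi]) (by simp [← hl]),
      ShortComplex.moduleCat_exact_iff] at this
    exact this z hz
  · intro h j
    rw [K.exactAt_iff' (j + 1) j (j - 1) (by simp) (by simp), ShortComplex.moduleCat_exact_iff]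
    exact h _ _ _ rfl (by lia)

namespace TwistedComplex

variable {k : Type u} [CommRing k] {A B : TwistedComplex k}

/-! ### Exactness of the vertical complexes and of the total complex -/

theorem moduleCat_shortExact {M N P : ModuleCat.{u} k} {f : M ⟶ N} {g : N ⟶ P} (w : f ≫ g = 0)
    (hf : Function.Injective f) (hg : Function.Surjective g) (h : Function.Exact f g) :
    (ShortComplex.mk f g w).ShortExact where
  exact := (ShortComplex.ShortExact.moduleCat_exact_iff_function_exact _).2 h
  mono_f := (ModuleCat.mono_iff_injective _).2 hf
  epi_g := (ModuleCat.epi_iff_surjective _).2 hg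

scoped instance (p : ℤ) : (vertical (k := k) p).Additive where
  map_add := rfl

scoped instance : (Tot (k := k)).PreservesZeroMorphisms where
  map_zero A B := HomologicalComplex.hom_ext _ _ fun n => ModuleCat.hom_ext <|
    DirectSum.linearMap_ext k fun p => LinearMap.ext fun x => by
      refine (DirectSum.lmap_lof _ _ _).trans ?_
      exact map_zero _

theorem vertical_shortExact {S : ShortComplex (TwistedComplex k)} (hS : S.ShortExact) (p : ℤ) :
    (S.map (vertical p)).ShortExact :=
  HomologicalComplex.shortExact_of_degreewise_shortExact _ fun q =>
    moduleCat_shortExact (by exact congrArg (fun F => Hom.f F p q) S.zero)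
      ((mono_iff_injective S.f).1 hS.mono_f p q)
      ((epi_iff_surjective S.g).1 hS.epi_g p q) (exact_f hS.exact p q)

theorem Tot_shortExact {S : ShortComplex (TwistedComplex k)} (hS : S.ShortExact) :
    (S.map Tot).ShortExact :=
  HomologicalComplex.shortExact_of_degreewise_shortExact _ fun n => by
    have h0 := (S.map Tot).zero
    have h1 := congrArg (fun F => HomologicalComplex.Hom.f F n) h0
    refine moduleCat_shortExact (by exact h1)
      (DirectSum.lmap_injective _ |>.2 fun p => (mono_iff_injective S.f).1 hS.mono_f p _)
      (DirectSum.lmap_surjective _ |>.2 fun p => (epi_iff_surjective S.g).1 hS.epi_g p _) ?_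
    refine LinearMap.exact_iff.2 ?_
    change LinearMap.ker (DirectSum.lmap fun p : ℕ => (S.g.f p (n - p)).hom) =
      LinearMap.range (DirectSum.lmap fun p : ℕ => (S.f.f p (n - p)).hom)
    rw [DirectSum.ker_lmap, DirectSum.range_lmap]
    congr 2
    funext p
    exact LinearMap.exact_iff.1 (exact_f hS.exact p _)

theorem quasiIso_vertical_iff (F : A ⟶ B) [Epi F] (p : ℤ) :
    QuasiIso ((vertical p).map F) ↔ ((vertical p).obj (kernel F)).Acyclic :=
  HomologicalComplex.quasiIso_g_iff (vertical_shortExact (shortExact_kernel F) p)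

theorem quasiIso_Tot_iff_kernel (F : A ⟶ B) [Epi F] :
    QuasiIso (Tot.map F) ↔ (Tot.obj (kernel F)).Acyclic :=
  HomologicalComplex.quasiIso_g_iff (Tot_shortExact (shortExact_kernel F))

theorem quasiIso_Tot_iff_cokernel (F : A ⟶ B) [Mono F] :
    QuasiIso (Tot.map F) ↔ (Tot.obj (cokernel F)).Acyclic :=
  HomologicalComplex.quasiIso_f_iff (Tot_shortExact (shortExact_cokernel F))

/-! ### Columns and the total complex -/

theorem vertical_acyclic_iff (A : TwistedComplex k) (p : ℤ) :
    ((vertical p).obj A).Acyclic ↔ ∀ (i j l : ℤ), j + 1 = i → l + 1 = j → ∀ z : A.X p j,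
      A.d 0 p j p l z = 0 → ∃ w : A.X p i, A.d 0 p i p j w = z :=
  ChainComplex.acyclic_iff _

theorem Tot_acyclic_iff (A : TwistedComplex k) :
    (Tot.obj A).Acyclic ↔ ∀ (i j l : ℤ), j + 1 = i → l + 1 = j → ∀ z : A.TotX j,
      A.totD j l z = 0 → ∃ w : A.TotX i, A.totD i j w = z :=
  ChainComplex.acyclic_iff _

/-- The inclusion of the summand in column `p` into the total complex. -/
abbrev totι (A : TwistedComplex k) (n : ℤ) (p : ℕ) : A.X p (n - p) →ₗ[k] A.TotX n :=
  DirectSum.lof k ℕ (fun p : ℕ => A.X p (n - p)) p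

theorem totι_apply_self (A : TwistedComplex k) (n : ℤ) (p : ℕ) (x : A.X p (n - p)) :
    A.totι n p x p = x :=
  DirectSum.lof_apply (M := fun p : ℕ => A.X p (n - p)) k p x

theorem totι_apply_of_ne (A : TwistedComplex k) (n : ℤ) {p r : ℕ} (h : p ≠ r)
    (x : A.X p (n - p)) : A.totι n p x r = 0 :=
  DirectSum.of_eq_of_ne _ _ _ h.symm

theorem totX_apply_sum (A : TwistedComplex k) (n : ℤ) {ι : Type*} (s : Finset ι)
    (f : ι → A.TotX n) (r : ℕ) : (∑ i ∈ s, f i) r = ∑ i ∈ s, f i r :=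
  DFinsupp.finsetSum_apply s f r

theorem totD_totι_apply (A : TwistedComplex k) (n m : ℤ) (p r : ℕ) (x : A.X p (n - p))
    (h : r ≤ p) :
    A.totD n m (A.totι n p x) r = A.d (p - r) p (n - p) r (m - r) x := by
  rw [totD_lof, totX_apply_sum, Finset.sum_eq_single (p - r, r)]
  · exact totι_apply_self _ _ _ _
  · rintro ⟨i, r'⟩ h1 h2
    rw [Finset.HasAntidiagonal.mem_antidiagonal] at h1
    refine totι_apply_of_ne _ _ ?_ _
    rintro rfl
    dsimp only at h1
    exact h2 (by rw [← h1]; simp)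
  · intro h1
    exact absurd (Finset.HasAntidiagonal.mem_antidiagonal.2 (by lia)) h1

theorem totD_totι_apply_of_lt (A : TwistedComplex k) (n m : ℤ) (p r : ℕ) (x : A.X p (n - p))
    (h : p < r) : A.totD n m (A.totι n p x) r = 0 := by
  rw [totD_lof, totX_apply_sum]
  refine Finset.sum_eq_zero fun ip hip => totι_apply_of_ne _ _ ?_ _
  rw [Finset.HasAntidiagonal.mem_antidiagonal] at hip
  lia

theorem totD_totι_apply_self (A : TwistedComplex k) (n m : ℤ) (p : ℕ) (x : A.X p (n - p)) :
    A.totD n m (A.totι n p x) p = A.d 0 p (n - p) p (m - p) x := by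
  have h := A.totD_totι_apply n m p p x le_rfl
  rwa [Nat.sub_self] at h

theorem totX_eq_sum (A : TwistedComplex k) (n : ℤ) (z : A.TotX n) :
    ∃ s : Finset ℕ, (∀ p, p ∉ s → z p = 0) ∧ z = ∑ p ∈ s, A.totι n p (z p) := by
  classical
  refine ⟨DFinsupp.support z, fun p hp => by simpa using hp, ?_⟩
  exact (DirectSum.sum_support_of z).symm

/-- No `d_i` raises the column, so only `d_0` of the top column contributes to the top column of the
differential. -/
theorem totD_apply_of_forall_lt (A : TwistedComplex k) (n m : ℤ) (r : ℕ) (z : A.TotX n)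
    (hz : ∀ p, r < p → z p = 0) : A.totD n m z r = A.d 0 r (n - r) r (m - r) (z r) := by
  obtain ⟨s, hs, e⟩ := A.totX_eq_sum n z
  have e' : A.totD n m z r = ∑ p ∈ s, A.totD n m (A.totι n p (z p)) r := by
    conv_lhs => rw [e, map_sum, totX_apply_sum]
  rw [e', Finset.sum_eq_single r]
  · exact totD_totι_apply_self _ _ _ _ _
  · intro p _ hp
    rcases lt_or_gt_of_ne hp with h | h
    · exact totD_totι_apply_of_lt _ _ _ _ _ _ h
    · rw [hz p h, map_zero, map_zero]
      rfl
  · intro hr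
    rw [hs r hr, map_zero, map_zero]
    rfl

theorem exists_forall_lt (A : TwistedComplex k) (n : ℤ) (z : A.TotX n) :
    ∃ m : ℕ, ∀ p, m ≤ p → z p = 0 := by
  obtain ⟨s, hs, -⟩ := A.totX_eq_sum n z
  refine ⟨s.sup id + 1, fun p hp => hs p fun h => ?_⟩
  have := Finset.le_sup (f := id) h
  dsimp at this
  lia

theorem totD_totD (A : TwistedComplex k) (i j l : ℤ) (h : j + 1 = i) (z : A.TotX i) :
    A.totD j l (A.totD i j z) = 0 :=
  LinearMap.congr_fun (A.totD_comp_totD i j l h) z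

/-- Induction on a bound for the columns in which a cycle lives: its top component is a `d_0`-cycle,
hence a `d_0`-boundary, and subtracting the corresponding total boundary lowers the bound.
Finiteness of the elements of the direct sum starts the induction. -/
theorem Tot_acyclic_of_vertical_acyclic (A : TwistedComplex k)
    (h : ∀ p : ℤ, 0 ≤ p → ((vertical p).obj A).Acyclic) : (Tot.obj A).Acyclic := by
  rw [Tot_acyclic_iff]
  intro i j l hi hl z hz
  obtain ⟨m, hm⟩ := A.exists_forall_lt j z
  induction m generalizing z with
  | zero =>
    refine ⟨0, ?_⟩
    rw [map_zero]
    exact (DFinsupp.ext fun p => hm p (Nat.zero_le p)).symm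
  | succ m ih =>
    have hzm := A.totD_apply_of_forall_lt j l m z hm
    rw [hz] at hzm
    obtain ⟨u, hu⟩ := (A.vertical_acyclic_iff m).1 (h m (by lia)) (i - m) (j - m) (l - m)
      (by lia) (by lia) (z m) hzm.symm
    obtain ⟨w, hw⟩ := ih (z - A.totD i j (A.totι i m u))
      (by rw [map_sub, hz, totD_totD _ _ _ _ hi, sub_zero]) (fun p hp => by
        change z p - A.totD i j (A.totι i m u) p = 0
        rcases eq_or_lt_of_le hp with rfl | hp
        · rw [totD_totι_apply_self, hu, sub_self]
        · rw [totD_totι_apply_of_lt _ _ _ _ _ _ hp, hm p hp, sub_zero])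
    refine ⟨w + A.totι i m u, ?_⟩
    rw [map_add, hw, sub_add_cancel]

/-- A vertical cycle in column zero is a cycle of `Tot`, hence the boundary of some `U`. As the
boundary of `U` lies in column zero, the top component of `U` is a `d_0`-cycle as long as its column
is positive. Subtracting a total boundary from `U` removes that component and leaves the boundary of
`U` unchanged, until `U` itself lies in column zero. -/
theorem vertical_zero_acyclic (A : TwistedComplex k)
    (h : ∀ p : ℤ, 0 < p → ((vertical p).obj A).Acyclic) (hT : (Tot.obj A).Acyclic) :
    ((vertical 0).obj A).Acyclic := by
  have key (i j l n : ℤ) (hi : j + 1 = i) (hl : l + 1 = j) (hn : i + 1 = n)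
      (z : A.X (0 : ℕ) (j - (0 : ℕ))) (m : ℕ) (U : A.TotX i) (hm : ∀ p, m < p → U p = 0)
      (hU : A.totD i j U = A.totι j 0 z) :
      ∃ w : A.X (0 : ℕ) (i - (0 : ℕ)),
        A.d 0 (0 : ℕ) (i - (0 : ℕ)) (0 : ℕ) (j - (0 : ℕ)) w = z := by
    induction m generalizing U with
    | zero =>
      refine ⟨U 0, ?_⟩
      rw [← A.totD_apply_of_forall_lt i j 0 U hm, hU, totι_apply_self]
    | succ m ih =>
      have hUm := A.totD_apply_of_forall_lt i j (m + 1) U hm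
      rw [hU, totι_apply_of_ne _ _ (by lia)] at hUm
      obtain ⟨v, hv⟩ := (A.vertical_acyclic_iff (m + 1 : ℕ)).1 (h _ (by lia)) (n - (m + 1 : ℕ))
        (i - (m + 1 : ℕ)) (j - (m + 1 : ℕ)) (by lia) (by lia) (U (m + 1)) hUm.symm
      refine ih (U - A.totD n i (A.totι n (m + 1) v)) (fun p hp => ?_) ?_
      · change U p - A.totD n i (A.totι n (m + 1) v) p = 0
        rcases eq_or_lt_of_le (Nat.succ_le_of_lt hp) with rfl | hp
        · rw [totD_totι_apply_self, hv, sub_self]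
        · rw [totD_totι_apply_of_lt _ _ _ _ _ _ hp, hm p hp, sub_zero]
      · rw [map_sub, totD_totD _ _ _ _ hn, sub_zero, hU]
  have e : (0 : ℤ) = (0 : ℕ) := rfl
  rw [e, vertical_acyclic_iff]
  intro i j l hi hl z hz
  obtain ⟨i, rfl⟩ : ∃ n : ℤ, i = n - (0 : ℕ) := ⟨i, by simp⟩
  obtain ⟨j, rfl⟩ : ∃ n : ℤ, j = n - (0 : ℕ) := ⟨j, by simp⟩
  obtain ⟨l, rfl⟩ : ∃ n : ℤ, l = n - (0 : ℕ) := ⟨l, by simp⟩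
  have hz' : A.totD j l (A.totι j 0 z) = 0 := by
    refine DFinsupp.ext fun r => ?_
    rcases Nat.eq_zero_or_pos r with rfl | hr
    · exact (totD_totι_apply_self _ _ _ _ _).trans hz
    · exact totD_totι_apply_of_lt _ _ _ _ _ _ hr
  obtain ⟨U, hU⟩ := A.Tot_acyclic_iff.1 hT i j l (by lia) (by lia) _ hz'
  obtain ⟨m, hm⟩ := A.exists_forall_lt i U
  exact key i j l (i + 1) (by lia) (by lia) rfl z m U (fun p hp => hm p hp.le) hU

/-! ### Lifting properties -/

/-- The condition on a morphism expressing the right lifting property with respect to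
`∂_v D̃^{p,q} ⟶ D̃^{p,q}`. -/
def LiftsDiscs (F : A ⟶ B) (p q : ℤ) : Prop :=
  ∀ (y : B.X p q) (x : A.X p (q - 1)), A.d 0 p (q - 1) p (q - 1 - 1) x = 0 →
    F.f p (q - 1) x = B.d 0 p q p (q - 1) y →
    ∃ x' : A.X p q, A.d 0 p q p (q - 1) x' = x ∧ F.f p q x' = y

theorem hasLiftingProperty_boundaryInclusion_iff (F : A ⟶ B) (p q : ℤ) :
    HasLiftingProperty (boundaryInclusion k p q) F ↔ LiftsDiscs F p q := by
  constructor
  · intro _ y x hx hxy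
    have sq : CommSq (boundaryDesc p q x hx) (boundaryInclusion k p q) F
        ((discHomEquiv p q B).symm y) := ⟨cyclic_hom_ext (by
      refine (congrArg (F.f p (q - 1)) (boundaryDesc_gen p q x hx)).trans (hxy.trans ?_)
      refine Eq.trans ?_ (congrArg (((discHomEquiv p q B).symm y).f p (q - 1))
        (boundaryInclusion_gen p q).symm)
      refine Eq.trans ?_ (comm_apply _ _ _ _ _ _ _)
      exact congrArg _ ((discHomEquiv p q B).apply_symm_apply y).symm)⟩
    refine ⟨discHomEquiv p q A sq.lift, ?_, ?_⟩
    · refine (comm_apply sq.lift _ _ _ _ _ _).trans ?_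
      rw [← boundaryInclusion_gen]
      refine Eq.trans ?_ (boundaryDesc_gen p q x hx)
      exact congrArg (fun G : boundary k p q ⟶ A => G.f p (q - 1) (cyclicGen {[0]} p (q - 1)))
        sq.fac_left
    · refine Eq.trans ?_ ((discHomEquiv p q B).apply_symm_apply y)
      exact congrArg (discHomEquiv p q B) sq.fac_right
  · intro h
    refine ⟨fun {a b} sq => ⟨⟨?_⟩⟩⟩
    have := h (discHomEquiv p q B b) (a.f p (q - 1) (cyclicGen {[0]} p (q - 1)))
      (by
        refine (comm_apply a _ _ _ _ _ _).trans ?_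
        refine (congrArg _ (d_zero_boundary_gen p q)).trans (map_zero _))
      (by
        refine (congrArg (fun G : boundary k p q ⟶ B =>
          G.f p (q - 1) (cyclicGen {[0]} p (q - 1))) sq.w).trans ?_
        refine (congrArg (b.f p (q - 1)) (boundaryInclusion_gen p q)).trans ?_
        exact (comm_apply b _ _ _ _ _ _).symm)
    refine ⟨(discHomEquiv p q A).symm this.choose, cyclic_hom_ext ?_, ?_⟩
    · refine (congrArg (((discHomEquiv p q A).symm this.choose).f p (q - 1))
        (boundaryInclusion_gen p q)).trans ?_
      refine (comm_apply _ _ _ _ _ _ _).symm.trans ?_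
      refine Eq.trans ?_ this.choose_spec.1
      exact congrArg _ ((discHomEquiv p q A).apply_symm_apply _)
    · refine (discHomEquiv p q B).injective ?_
      refine Eq.trans ?_ this.choose_spec.2
      exact congrArg _ ((discHomEquiv p q A).apply_symm_apply _)

theorem hasLiftingProperty_zero_disc_iff (F : A ⟶ B) (p q : ℤ) :
    HasLiftingProperty (0 : zero k ⟶ disc k p q) F ↔ Function.Surjective (F.f p q) := by
  constructor
  · intro _ y
    have sq : CommSq 0 (0 : zero k ⟶ disc k p q) F ((discHomEquiv p q B).symm y) :=
      ⟨(isZero_zero k).eq_of_src _ _⟩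
    refine ⟨discHomEquiv p q A sq.lift, ?_⟩
    refine Eq.trans ?_ ((discHomEquiv p q B).apply_symm_apply y)
    exact congrArg (discHomEquiv p q B) sq.fac_right
  · intro h
    refine ⟨fun {a b} sq => ⟨⟨?_⟩⟩⟩
    refine ⟨(discHomEquiv p q A).symm (h (discHomEquiv p q B b)).choose,
      (isZero_zero k).eq_of_src _ _, (discHomEquiv p q B).injective ?_⟩
    refine Eq.trans ?_ (h (discHomEquiv p q B b)).choose_spec
    exact congrArg _ ((discHomEquiv p q A).apply_symm_apply _)

/-- The lifting property at `(p, q)` needs a cycle over `d_0 y` to begin with. The property at `(p,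
q - 1)`, applied to `d_0 y` and the zero cycle, provides it. -/
theorem surjective_of_liftsDiscs {F : A ⟶ B} {p : ℤ} (h : ∀ q, LiftsDiscs F p q) (q : ℤ) :
    Function.Surjective (F.f p q) := by
  intro y
  obtain ⟨x, hx, hxy⟩ := h (q - 1) (B.d 0 p q p (q - 1) y) 0 (map_zero _)
    (by rw [map_zero, d_zero_d_zero])
  obtain ⟨x', -, hx'⟩ := h q y x hx hxy
  exact ⟨x', hx'⟩

theorem vertical_kernel_acyclic_iff (F : A ⟶ B) (p : ℤ) :
    ((vertical p).obj (kernel F)).Acyclic ↔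
      ∀ (i j l : ℤ), j + 1 = i → l + 1 = j → ∀ z : A.X p j, F.f p j z = 0 → A.d 0 p j p l z = 0 →
        ∃ w : A.X p i, F.f p i w = 0 ∧ A.d 0 p i p j w = z := by
  rw [vertical_acyclic_iff]
  refine forall_congr' fun i => forall_congr' fun j => forall_congr' fun l =>
    forall_congr' fun hi => forall_congr' fun hl => ?_
  constructor
  · intro h z hz hdz
    obtain ⟨z, rfl⟩ := (exact_kernel_ι F p j z).1 hz
    rw [comm_apply] at hdz
    obtain ⟨w, rfl⟩ := h z (kernel_ι_injective F p l (hdz.trans (map_zero _).symm))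
    exact ⟨(kernel.ι F).f p i w, (exact_kernel_ι F p i _).2 ⟨w, rfl⟩, comm_apply _ _ _ _ _ _ _⟩
  · intro h z hz
    obtain ⟨w, hw, hdw⟩ := h ((kernel.ι F).f p j z) ((exact_kernel_ι F p j _).2 ⟨z, rfl⟩)
      (by rw [comm_apply, hz, map_zero])
    obtain ⟨w, rfl⟩ := (exact_kernel_ι F p i w).1 hw
    exact ⟨w, kernel_ι_injective F p j ((comm_apply _ _ _ _ _ _ _).symm.trans hdw)⟩

/-- For the converse, take any preimage of `y`; its `d_0` differs from the prescribed `x` by a cycle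
in the kernel, and a primitive of that cycle in the kernel corrects the preimage. -/
theorem liftsDiscs_iff (F : A ⟶ B) (p : ℤ) :
    (∀ q, LiftsDiscs F p q) ↔
      (∀ q, Function.Surjective (F.f p q)) ∧ ((vertical p).obj (kernel F)).Acyclic := by
  rw [vertical_kernel_acyclic_iff]
  constructor
  · refine fun h => ⟨surjective_of_liftsDiscs h, fun i j l hi hl z hz hdz => ?_⟩
    obtain rfl : j = i - 1 := by lia
    obtain rfl : l = i - 1 - 1 := by lia
    obtain ⟨w, hw, hw'⟩ := h i 0 z hdz (by rw [hz, map_zero])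
    exact ⟨w, hw', hw⟩
  · rintro ⟨hs, h⟩ q y x hx hxy
    obtain ⟨x₀, rfl⟩ := hs q y
    obtain ⟨x₁, hx₁, hdx₁⟩ := h q (q - 1) (q - 1 - 1) (by lia) (by lia)
      (x - A.d 0 p q p (q - 1) x₀) (by rw [map_sub, hxy, comm_apply, sub_self])
      (by rw [map_sub, hx, d_zero_d_zero, sub_zero])
    exact ⟨x₀ + x₁, by rw [map_add, hdx₁, add_sub_cancel], by rw [map_add, hx₁, add_zero]⟩

theorem surjective_f_of_neg (F : A ⟶ B) (p q : ℤ) (hp : p < 0) :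
    Function.Surjective (F.f p q) := fun y => by
  have := ModuleCat.subsingleton_of_isZero (B.isZero_of_neg p q hp)
  exact ⟨0, Subsingleton.elim _ _⟩

theorem generatingCofibrations_rlp_iff (F : A ⟶ B) :
    (generatingCofibrations k).rlp F ↔
      Epi F ∧ ∀ p : ℤ, 0 ≤ p → ((vertical p).obj (kernel F)).Acyclic := by
  have h₁ : (generatingCofibrations k).rlp F ↔ ∀ (p : ℕ) (q : ℤ), LiftsDiscs F p q := by
    refine ⟨fun h p q => (hasLiftingProperty_boundaryInclusion_iff F p q).1
      (h _ (MorphismProperty.ofHoms.mk (p, q))), ?_⟩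
    rintro h _ _ _ ⟨p, q⟩
    exact (hasLiftingProperty_boundaryInclusion_iff F p q).2 (h p q)
  simp only [h₁, liftsDiscs_iff, epi_iff_surjective]
  refine ⟨fun h => ⟨fun p => ?_, fun p hp => ?_⟩, fun h p => ⟨h.1 p, h.2 p (by lia)⟩⟩
  -- The generators only see `p ≥ 0`; in negative columns the target is zero.
  · rcases lt_or_ge p 0 with hp | hp
    · exact fun q => surjective_f_of_neg F p q hp
    · obtain ⟨p, rfl⟩ := Int.eq_ofNat_of_zero_le hp
      exact (h p).1
  · obtain ⟨p, rfl⟩ := Int.eq_ofNat_of_zero_le hp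
    exact (h p).2

theorem generatingTrivialCofibrations_rlp_iff (F : A ⟶ B) :
    (generatingTrivialCofibrations k).rlp F ↔
      Epi F ∧ ∀ p : ℤ, 0 < p → ((vertical p).obj (kernel F)).Acyclic := by
  have h₁ : (generatingTrivialCofibrations k).rlp F ↔
      (∀ q, Function.Surjective (F.f 0 q)) ∧ ∀ (p : ℕ) (q : ℤ), LiftsDiscs F (p + 1) q := by
    refine ⟨fun h => ⟨fun q => (hasLiftingProperty_zero_disc_iff F 0 q).1
      (h _ (Or.inl (MorphismProperty.ofHoms.mk q))),
      fun p q => (hasLiftingProperty_boundaryInclusion_iff F (p + 1) q).1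
      (h _ (Or.inr (MorphismProperty.ofHoms.mk (p, q))))⟩, ?_⟩
    rintro h _ _ _ (⟨⟨q⟩⟩ | ⟨⟨p, q⟩⟩)
    · exact (hasLiftingProperty_zero_disc_iff F 0 q).2 (h.1 q)
    · exact (hasLiftingProperty_boundaryInclusion_iff F (p + 1) q).2 (h.2 p q)
  simp only [h₁, liftsDiscs_iff, epi_iff_surjective]
  have h₂ (p : ℤ) (hp : 0 < p) : ∃ r : ℕ, p = r + 1 := by
    obtain ⟨r, hr⟩ := Int.eq_ofNat_of_zero_le (show 0 ≤ p - 1 by lia)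
    exact ⟨r, by lia⟩
  refine ⟨fun h => ⟨fun p => ?_, fun p hp => ?_⟩,
    fun h => ⟨h.1 0, fun p => ⟨h.1 _, h.2 _ (by lia)⟩⟩⟩
  · rcases lt_trichotomy p 0 with hp | rfl | hp
    · exact fun q => surjective_f_of_neg F p q hp
    · exact h.1
    · obtain ⟨p, rfl⟩ := h₂ p hp
      exact (h.2 p).1
  · obtain ⟨p, rfl⟩ := h₂ p hp
    exact (h.2 p).2

theorem generatingCofibrations_rlp_iff_quasiIso (F : A ⟶ B) :
    (generatingCofibrations k).rlp F ↔
      (generatingTrivialCofibrations k).rlp F ∧ QuasiIso (Tot.map F) := by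
  rw [generatingCofibrations_rlp_iff, generatingTrivialCofibrations_rlp_iff]
  constructor
  · rintro ⟨_, h⟩
    refine ⟨⟨inferInstance, fun p hp => h p hp.le⟩, ?_⟩
    rw [quasiIso_Tot_iff_kernel]
    exact Tot_acyclic_of_vertical_acyclic _ h
  · rintro ⟨⟨_, h⟩, hT⟩
    refine ⟨inferInstance, fun p hp => ?_⟩
    rcases eq_or_lt_of_le hp with rfl | hp
    · exact vertical_zero_acyclic _ h ((quasiIso_Tot_iff_kernel F).1 hT)
    · exact h p hp

theorem surjective_and_isIso_homologyMap_iff (F : A ⟶ B) (P : ℤ → Prop) :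
    ((∀ p q : ℤ, Function.Surjective (F.f p q)) ∧
      ∀ p q : ℤ, P p → IsIso (HomologicalComplex.homologyMap ((vertical p).map F) q)) ↔
    Epi F ∧ ∀ p : ℤ, P p → ((vertical p).obj (kernel F)).Acyclic := by
  rw [← epi_iff_surjective]
  refine and_congr_right fun _ => forall_congr' fun p => ?_
  rw [← quasiIso_vertical_iff, quasiIso_iff]
  simp only [quasiIsoAt_iff_isIso_homologyMap]
  exact ⟨fun h hp q => h q hp, fun h q hp => h hp q⟩

end TwistedComplex

/-! ### Sums over antidiagonals without the end points -/

section InnerSum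

variable {M M' : Type*} [AddCommGroup M] [AddCommGroup M']

/-- `∑_{i + j + 1 = n} f i j`. -/
def innerSum (f : ℕ → ℕ → M) : ℕ → M
  | 0 => 0
  | n + 1 => ∑ ij ∈ Finset.HasAntidiagonal.antidiagonal n, f ij.1 ij.2

theorem map_innerSum {F : Type*} [FunLike F M M'] [AddMonoidHomClass F M M'] (g : F)
    (f : ℕ → ℕ → M) (n : ℕ) : g (innerSum f n) = innerSum (fun i j => g (f i j)) n := by
  cases n with
  | zero => exact map_zero g
  | succ n => exact map_sum g _ _

theorem innerSum_congr {f g : ℕ → ℕ → M} {n : ℕ} (h : ∀ i j, i + j + 1 = n → f i j = g i j) :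
    innerSum f n = innerSum g n := by
  cases n with
  | zero => rfl
  | succ n =>
    refine Finset.sum_congr rfl fun ij hij => h _ _ ?_
    rw [Finset.HasAntidiagonal.mem_antidiagonal] at hij
    lia

theorem innerSum_eq_zero {f : ℕ → ℕ → M} {n : ℕ} (h : ∀ i j, i + j + 1 = n → f i j = 0) :
    innerSum f n = 0 := by
  cases n with
  | zero => rfl
  | succ n =>
    refine Finset.sum_eq_zero fun ij hij => h _ _ ?_
    rw [Finset.HasAntidiagonal.mem_antidiagonal] at hij
    lia

theorem innerSum_add (f g : ℕ → ℕ → M) (n : ℕ) :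
    innerSum (fun i j => f i j + g i j) n = innerSum f n + innerSum g n := by
  cases n with
  | zero => exact (add_zero _).symm
  | succ n => exact Finset.sum_add_distrib

theorem innerSum_sub (f g : ℕ → ℕ → M) (n : ℕ) :
    innerSum (fun i j => f i j - g i j) n = innerSum f n - innerSum g n := by
  cases n with
  | zero => exact (sub_zero _).symm
  | succ n => exact Finset.sum_sub_distrib _ _

/-- Separates the two terms containing `d_0` from the others in the relation `∑ d_i d_j = 0` of
degree `n + 1`. -/
theorem sum_antidiagonal_succ_eq_innerSum (f : ℕ → ℕ → M) (n : ℕ) :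
    ∑ ij ∈ Finset.HasAntidiagonal.antidiagonal (n + 1), f ij.1 ij.2 =
      f 0 (n + 1) + f (n + 1) 0 + innerSum (fun i j => f (i + 1) (j + 1)) n := by
  cases n with
  | zero => simp [innerSum, Finset.Nat.antidiagonal_succ]
  | succ n =>
    rw [Finset.Nat.sum_antidiagonal_succ, Finset.Nat.sum_antidiagonal_succ', innerSum]
    dsimp only
    abel

/-- Both sides sum over triples with total `n - 2`, bracketed in two ways. For `n = 0` and `n = 1`
there are no such triples. -/
theorem innerSum_innerSum (f : ℕ → ℕ → ℕ → M) (n : ℕ) :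
    innerSum (fun i j => innerSum (fun a b => f a b j) i) n =
      innerSum (fun i j => innerSum (fun a b => f i a b) j) n := by
  obtain _ | _ | n := n
  · rfl
  · simp [innerSum]
  · simp only [innerSum]
    rw [Finset.Nat.sum_antidiagonal_succ, Finset.Nat.sum_antidiagonal_succ']
    simp only [zero_add]
    rw [Finset.sum_sigma', Finset.sum_sigma']
    refine Finset.sum_bij'
      (fun a _ => ⟨(a.2.1, a.2.2 + a.1.2), (a.2.2, a.1.2)⟩)
      (fun b _ => ⟨(b.1.1 + b.2.1, b.2.2), (b.1.1, b.2.1)⟩) ?_ ?_ ?_ ?_ ?_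
    · rintro ⟨⟨i, a⟩, ⟨j, b⟩⟩ h
      simp only [Finset.mem_sigma, Finset.HasAntidiagonal.mem_antidiagonal] at h ⊢
      exact ⟨by have := h.1; have := h.2; lia, trivial⟩
    · rintro ⟨⟨i, a⟩, ⟨j, b⟩⟩ h
      simp only [Finset.mem_sigma, Finset.HasAntidiagonal.mem_antidiagonal] at h ⊢
      exact ⟨by have := h.1; have := h.2; lia, trivial⟩
    · rintro ⟨⟨i, a⟩, ⟨j, b⟩⟩ h
      simp only [Finset.mem_sigma, Finset.HasAntidiagonal.mem_antidiagonal] at h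
      obtain ⟨rfl, rfl⟩ := h
      rfl
    · rintro ⟨⟨i, a⟩, ⟨j, b⟩⟩ h
      simp only [Finset.mem_sigma, Finset.HasAntidiagonal.mem_antidiagonal] at h
      obtain ⟨rfl, rfl⟩ := h
      rfl
    · rintro ⟨⟨i, a⟩, ⟨j, b⟩⟩ _
      rfl

end InnerSum

namespace TwistedComplex

variable {k : Type u} [CommRing k]

/-! ### Twisted complexes from operators on a filtered module -/

/-- The twisted complex with `X_{p,q} = W p` and all `d_i` given by operators `E i` independent of
the bidegree. -/
def ofOperators {M : Type u} [AddCommGroup M] [Module k M] (E : ℕ → M →ₗ[k] M)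
    (hE : ∀ n x, ∑ ij ∈ Finset.HasAntidiagonal.antidiagonal n, E ij.1 (E ij.2 x) = 0)
    (W : ℤ → Submodule k M) (hW : ∀ p < 0, W p = ⊥)
    (hEW : ∀ (i : ℕ) (p p' : ℤ), p' + (i : ℤ) = p → ∀ x ∈ W p, E i x ∈ W p') :
    TwistedComplex k where
  X p _ := ModuleCat.of k (W p)
  d i p q p' q' := open Classical in
    if h : p' + i = p ∧ q' + 1 = q + i then
      ModuleCat.ofHom ((E i).restrict (hEW i p p' h.1)) else 0
  isZero_of_neg p q hp := by
    have : Subsingleton (W p) := by rw [hW p hp]; infer_instance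
    exact ModuleCat.isZero_of_subsingleton _
  shape i p q p' q' h := dif_neg h
  sum_d_comp_d n p q p'' q'' := by
    by_cases h : p'' + n = p ∧ q'' + 2 = q + n
    · refine ModuleCat.hom_ext (LinearMap.ext fun x => Subtype.ext ?_)
      rw [ModuleCat.hom_sum, LinearMap.sum_apply, AddSubmonoidClass.coe_finsetSum]
      refine Eq.trans (Finset.sum_congr rfl fun ij hij => ?_) (hE n x)
      rw [Finset.HasAntidiagonal.mem_antidiagonal] at hij
      rw [dif_pos (by lia), dif_pos (by lia)]
      rfl
    · refine Finset.sum_eq_zero fun ij hij => ?_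
      rw [Finset.HasAntidiagonal.mem_antidiagonal] at hij
      by_cases h' : p'' + ij.1 = p - ij.2 ∧ q'' + 1 = q + ij.2 - 1 + ij.1
      · exact absurd h' (by lia)
      · rw [dif_neg h', comp_zero]

/-! ### The cofree vertically contractible twisted complex -/

section Cofree

variable (N N' : Type u) [AddCommGroup N] [Module k N] [AddCommGroup N'] [Module k N']

variable (k) in
/-- `φ ↦ (w ↦ φ(nw))`; the letter `n` stands for `d_{n+1}`. -/
def preCons (n : ℕ) : (List ℕ → N) →ₗ[k] (List ℕ → N) := LinearMap.funLeft k N (List.cons n)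

variable (k) in
/-- `∑_{i + j = n + 1, i, j ≥ 1} d_i d_j` -/
def innerOp (n : ℕ) : (List ℕ → N) →ₗ[k] (List ℕ → N) :=
  innerSum (fun i j => preCons k N i ∘ₗ preCons k N j) n

variable {N N'}

theorem innerOp_apply (n : ℕ) (φ : List ℕ → N) :
    innerOp k N n φ = innerSum (fun i j => preCons k N i (preCons k N j φ)) n :=
  map_innerSum (LinearMap.applyₗ (R := k) φ) (fun i j => preCons k N i ∘ₗ preCons k N j) n

variable (k N) in
/-- The values of `d_0 φ`. -/
def deltaAt : List ℕ → (List ℕ → N) →ₗ[k] N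
  | [] => 0
  -- This recursion is forced by `d_0 d_{n+1} + d_{n+1} d_0 + ∑_{i,j ≥ 1} d_i d_j = 0`. The value at
  -- the empty word is free and is normalized to zero.
  | n :: w => -(LinearMap.proj w ∘ₗ innerOp k N n) - deltaAt w ∘ₗ preCons k N n

variable (k N) in
/-- The differential `d_0` on functions on words. -/
def delta : (List ℕ → N) →ₗ[k] (List ℕ → N) := LinearMap.pi (deltaAt k N)

theorem preCons_delta (n : ℕ) (φ : List ℕ → N) :
    preCons k N n (delta k N φ) = -innerOp k N n φ - delta k N (preCons k N n φ) :=
  rfl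

/-- The defining recursion makes `delta` commute with `innerOp`, as the two triple sums that arise
cancel by `innerSum_innerSum`. Hence `delta ∘ delta` commutes with removing a letter, and it
vanishes at the empty word. -/
theorem delta_delta (φ : List ℕ → N) : delta k N (delta k N φ) = 0 := by
  funext w
  induction w generalizing φ with
  | nil => rfl
  | cons n w ih =>
    change preCons k N n (delta k N (delta k N φ)) w = 0
    have h (i j : ℕ) : preCons k N i (preCons k N j (delta k N φ)) =
        delta k N (preCons k N i (preCons k N j φ)) + innerOp k N i (preCons k N j φ) -
          preCons k N i (innerOp k N j φ) := by
      rw [preCons_delta, map_sub, map_neg, preCons_delta]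
      abel
    have h' : innerOp k N n (delta k N φ) = delta k N (innerOp k N n φ) := by
      rw [innerOp_apply]
      simp only [h]
      rw [innerSum_sub, innerSum_add, innerOp_apply, map_innerSum]
      simp only [innerOp_apply, map_innerSum]
      rw [innerSum_innerSum fun a b j => preCons k N a (preCons k N b (preCons k N j φ))]
      abel
    rw [preCons_delta, preCons_delta, map_sub, map_neg, h']
    simp [ih]

theorem innerOp_apply_apply (n : ℕ) (φ : List ℕ → N) (w : List ℕ) :
    innerOp k N n φ w = innerSum (fun i j => φ (j :: i :: w)) n := by
  rw [innerOp_apply]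
  exact map_innerSum (LinearMap.proj (R := k) (φ := fun _ : List ℕ => N) w)
    (fun i j => preCons k N i (preCons k N j φ)) n

theorem delta_compLeft (g : N →ₗ[k] N') (φ : List ℕ → N) :
    delta k N' (g.compLeft (List ℕ) φ) = g.compLeft (List ℕ) (delta k N φ) := by
  funext w
  induction w generalizing φ with
  | nil => exact (map_zero g).symm
  | cons n w ih =>
    change preCons k N' n (delta k N' (g.compLeft (List ℕ) φ)) w =
      g.compLeft (List ℕ) (preCons k N n (delta k N φ)) w
    have h : innerOp k N' n (g.compLeft (List ℕ) φ) =
        g.compLeft (List ℕ) (innerOp k N n φ) := by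
      rw [innerOp_apply, innerOp_apply, map_innerSum]
      rfl
    have h' := ih (preCons k N n φ)
    rw [preCons_delta, preCons_delta, map_sub, map_neg, h]
    exact congrArg (_ - ·) h'

/-- The weight of a word. -/
def wordWeight : List ℕ → ℕ
  | [] => 0
  | n :: w => n + 1 + wordWeight w

/-- The recursion only splits a letter `n` into letters `i`, `j` with `i + j + 1 = n`, which
preserves the weight. This makes the support condition of `cofreeSubmodule` stable under `d_0`. -/
theorem delta_apply_eq_zero (φ : List ℕ → N) (w : List ℕ)
    (h : ∀ w', wordWeight w' = wordWeight w → φ w' = 0) : delta k N φ w = 0 := by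
  induction w generalizing φ with
  | nil => rfl
  | cons n w ih =>
    change preCons k N n (delta k N φ) w = 0
    have h₁ : innerOp k N n φ w = 0 := by
      rw [innerOp_apply_apply]
      exact innerSum_eq_zero fun i j hij => h _ (by simp only [wordWeight]; lia)
    have h₂ : delta k N (preCons k N n φ) w = 0 :=
      ih _ fun w' hw' => h (n :: w') (by simp only [wordWeight]; lia)
    rw [preCons_delta, Pi.sub_apply, Pi.neg_apply, h₁, h₂, neg_zero, sub_zero]

variable (k N) in
/-- The operators `d_i` on pairs of functions on words. -/
def cofreeOp : ℕ → ((List ℕ → N) × (List ℕ → N) →ₗ[k] (List ℕ → N) × (List ℕ → N))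
  -- As in a cone on the identity, the second function records the defect `d_0 - delta` on the
  -- first. The signs on the second factor make the mixed terms cancel in the relations.
  | 0 => LinearMap.prod (delta k N ∘ₗ LinearMap.fst k _ _ + LinearMap.snd k _ _)
      (-(delta k N ∘ₗ LinearMap.snd k _ _))
  | n + 1 => LinearMap.prodMap (preCons k N n) (-preCons k N n)

theorem cofreeOp_zero (x : (List ℕ → N) × (List ℕ → N)) :
    cofreeOp k N 0 x = (delta k N x.1 + x.2, -delta k N x.2) :=
  rfl

theorem cofreeOp_succ (n : ℕ) (x : (List ℕ → N) × (List ℕ → N)) :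
    cofreeOp k N (n + 1) x = (preCons k N n x.1, -preCons k N n x.2) :=
  rfl

theorem innerSum_cofreeOp (n : ℕ) (x : (List ℕ → N) × (List ℕ → N)) :
    innerSum (fun i j => cofreeOp k N (i + 1) (cofreeOp k N (j + 1) x)) n =
      (innerOp k N n x.1, innerOp k N n x.2) := by
  rw [innerOp_apply, innerOp_apply]
  refine Prod.ext ?_ ?_
  · exact map_innerSum (LinearMap.fst k (List ℕ → N) (List ℕ → N))
      (fun i j => cofreeOp k N (i + 1) (cofreeOp k N (j + 1) x)) n
  · refine (map_innerSum (LinearMap.snd k (List ℕ → N) (List ℕ → N))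
      (fun i j => cofreeOp k N (i + 1) (cofreeOp k N (j + 1) x)) n).trans ?_
    refine innerSum_congr (g := fun i j => preCons k N i (preCons k N j x.2)) fun i j _ => ?_
    change -preCons k N i (-preCons k N j x.2) = preCons k N i (preCons k N j x.2)
    rw [map_neg, neg_neg]

theorem sum_cofreeOp (n : ℕ) (x : (List ℕ → N) × (List ℕ → N)) :
    ∑ ij ∈ Finset.HasAntidiagonal.antidiagonal n,
      cofreeOp k N ij.1 (cofreeOp k N ij.2 x) = 0 := by
  cases n with
  | zero =>
    rw [Finset.Nat.antidiagonal_zero, Finset.sum_singleton, cofreeOp_zero, cofreeOp_zero]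
    simp only [map_add, map_neg, delta_delta]
    simp
  | succ n =>
    rw [sum_antidiagonal_succ_eq_innerSum (fun i j => cofreeOp k N i (cofreeOp k N j x)),
      innerSum_cofreeOp, cofreeOp_zero, cofreeOp_zero, cofreeOp_succ, cofreeOp_succ]
    simp only [map_add, map_neg, preCons_delta, Prod.mk_add_mk, Prod.mk_eq_zero]
    constructor <;> abel

variable (k N) in
/-- Pairs of functions supported on words of weight at most `p`. -/
def cofreeSubmodule (p : ℤ) : Submodule k ((List ℕ → N) × (List ℕ → N)) where
  carrier := {x | ∀ w, p < wordWeight w → x.1 w = 0 ∧ x.2 w = 0}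
  add_mem' {x y} hx hy w hw := by simp [hx w hw, hy w hw]
  zero_mem' w hw := by simp
  smul_mem' c x hx w hw := by simp [hx w hw]

theorem cofreeSubmodule_of_neg (p : ℤ) (hp : p < 0) : cofreeSubmodule k N p = ⊥ := by
  rw [eq_bot_iff]
  intro x hx
  exact Prod.ext (funext fun w => (hx w (by lia)).1) (funext fun w => (hx w (by lia)).2)

theorem cofreeOp_mem (i : ℕ) (p p' : ℤ) (h : p' + (i : ℤ) = p)
    (x : (List ℕ → N) × (List ℕ → N)) (hx : x ∈ cofreeSubmodule k N p) :
    cofreeOp k N i x ∈ cofreeSubmodule k N p' := by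
  intro w hw
  cases i with
  | zero =>
    obtain rfl : p' = p := by simpa using h
    have h₁ : delta k N x.1 w = 0 :=
      delta_apply_eq_zero _ _ fun w' hw' => (hx w' (by rwa [hw'])).1
    have h₂ : delta k N x.2 w = 0 :=
      delta_apply_eq_zero _ _ fun w' hw' => (hx w' (by rwa [hw'])).2
    rw [cofreeOp_zero]
    simp [h₁, h₂, hx w hw]
  | succ i =>
    have := hx (i :: w) (by simp only [wordWeight]; push_cast at h ⊢; lia)
    exact ⟨this.1, neg_eq_zero.2 this.2⟩

variable (k N) in
/-- The cofree vertically contractible twisted complex on a module. -/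
def cofree : TwistedComplex k :=
  ofOperators (cofreeOp k N) sum_cofreeOp (cofreeSubmodule k N) cofreeSubmodule_of_neg
    cofreeOp_mem

/-- Elements of the cofree twisted complex. -/
def cofreeMk (p q : ℤ) (x : (List ℕ → N) × (List ℕ → N)) (hx : x ∈ cofreeSubmodule k N p) :
    (cofree k N).X p q :=
  (⟨x, hx⟩ : cofreeSubmodule k N p)

variable (k N) in
/-- The underlying pair of functions of an element of the cofree twisted complex. -/
def cofreeVal (p q : ℤ) : (cofree k N).X p q →ₗ[k] (List ℕ → N) × (List ℕ → N) :=
  (cofreeSubmodule k N p).subtype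

theorem cofreeVal_mem (p q : ℤ) (x : (cofree k N).X p q) :
    cofreeVal k N p q x ∈ cofreeSubmodule k N p :=
  Subtype.property (p := fun x => x ∈ cofreeSubmodule k N p) x

theorem cofreeVal_injective (p q : ℤ) : Function.Injective (cofreeVal k N p q) :=
  Subtype.val_injective

theorem cofreeVal_mk (p q : ℤ) (x : (List ℕ → N) × (List ℕ → N))
    (hx : x ∈ cofreeSubmodule k N p) : cofreeVal k N p q (cofreeMk p q x hx) = x :=
  rfl

theorem cofreeVal_d (i : ℕ) (p q p' q' : ℤ) (h : p' + i = p ∧ q' + 1 = q + i)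
    (x : (cofree k N).X p q) :
    cofreeVal k N p' q' ((cofree k N).d i p q p' q' x) = cofreeOp k N i (cofreeVal k N p q x) := by
  have e : (cofree k N).d i p q p' q' =
    ModuleCat.ofHom ((cofreeOp k N i).restrict (cofreeOp_mem i p p' h.1)) := dif_pos h
  rw [e]
  rfl

/-- A morphism to a cofree twisted complex is given by compatible maps to pairs of functions. -/
def toCofree {A : TwistedComplex k}
    (F : ∀ p q, A.X p q →ₗ[k] (List ℕ → N) × (List ℕ → N))
    (hF : ∀ p q x, F p q x ∈ cofreeSubmodule k N p)
    (comm : ∀ (i : ℕ) (p q p' q' : ℤ) (x : A.X p q), p' + i = p ∧ q' + 1 = q + i →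
      cofreeOp k N i (F p q x) = F p' q' (A.d i p q p' q' x)) : A ⟶ cofree k N where
  f p q := ModuleCat.ofHom (Y := cofreeSubmodule k N p)
    (LinearMap.codRestrict (cofreeSubmodule k N p) (F p q) (hF p q))
  comm i p q p' q' := by
    by_cases h : p' + i = p ∧ q' + 1 = q + i
    · refine ModuleCat.hom_ext (LinearMap.ext fun x => cofreeVal_injective p' q' ?_)
      exact (cofreeVal_d i p q p' q' h _).trans (comm i p q p' q' x h)
    · rw [A.shape _ _ _ _ _ h, (cofree k N).shape _ _ _ _ _ h]
      exact comp_zero.trans zero_comp.symm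

/-- Functoriality of the cofree twisted complex. -/
def cofreeMap (g : N →ₗ[k] N') : cofree k N ⟶ cofree k N' :=
  toCofree (fun p q =>
      LinearMap.prodMap (g.compLeft (List ℕ)) (g.compLeft (List ℕ)) ∘ₗ cofreeVal k N p q)
    (fun p q x w hw => by
      have := cofreeVal_mem p q x w hw
      exact ⟨(congrArg g this.1).trans (map_zero g), (congrArg g this.2).trans (map_zero g)⟩)
    (fun i p q p' q' x h => by
      rw [LinearMap.comp_apply, LinearMap.comp_apply, cofreeVal_d i p q p' q' h]
      generalize cofreeVal k N p q x = y
      cases i with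
      | zero =>
        rw [cofreeOp_zero, cofreeOp_zero]
        simp [delta_compLeft]
      | succ i =>
        rw [cofreeOp_succ, cofreeOp_succ]
        simp only [LinearMap.prodMap_apply, map_neg]
        rfl)

theorem cofreeVal_map (g : N →ₗ[k] N') (p q : ℤ) (x : (cofree k N).X p q) :
    cofreeVal k N' p q ((cofreeMap g).f p q x) =
      (g.compLeft (List ℕ) (cofreeVal k N p q x).1, g.compLeft (List ℕ) (cofreeVal k N p q x).2) :=
  rfl

theorem cofreeMap_rlp (g : N →ₗ[k] N') (hg : Function.Surjective g) :
    (generatingCofibrations k).rlp (cofreeMap g) := by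
  rw [generatingCofibrations_rlp_iff]
  constructor
  · rw [epi_iff_surjective]
    intro p q y
    classical
    -- The chosen preimage of zero need not be zero, so words of weight above `p` are sent to zero
    -- by hand.
    let σ (φ : List ℕ → N') : List ℕ → N :=
      fun w => if p < wordWeight w then 0 else Function.surjInv hg (φ w)
    have hσ (φ : List ℕ → N') (h : ∀ w, p < wordWeight w → φ w = 0) :
        g.compLeft (List ℕ) (σ φ) = φ := by
      funext w
      change g (σ φ w) = φ w
      by_cases hw : p < wordWeight w
      · simp only [σ, if_pos hw, h w hw, map_zero]
      · simp only [σ, if_neg hw, Function.surjInv_eq]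
    have hmem : (σ (cofreeVal k N' p q y).1, σ (cofreeVal k N' p q y).2) ∈
        cofreeSubmodule k N p := fun w hw => ⟨if_pos hw, if_pos hw⟩
    refine ⟨cofreeMk p q _ hmem, cofreeVal_injective p q ?_⟩
    rw [cofreeVal_map, cofreeVal_mk]
    exact Prod.ext (hσ _ fun w hw => (cofreeVal_mem p q y w hw).1)
      (hσ _ fun w hw => (cofreeVal_mem p q y w hw).2)
  · intro p _
    rw [vertical_kernel_acyclic_iff]
    intro i j l hi hl z hz hdz
    -- The vertical contraction is `(φ, ψ) ↦ (0, φ)`: one has `d_0 (0, φ) = (φ, -δφ)`, and `ψ = -δφ`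
    -- on cycles.
    have hmem : ((0, (cofreeVal k N p j z).1) : (List ℕ → N) × (List ℕ → N)) ∈
        cofreeSubmodule k N p := fun w hw => ⟨rfl, (cofreeVal_mem p j z w hw).1⟩
    have hz' := congrArg (cofreeVal k N' p j) hz
    have hdz' := congrArg (cofreeVal k N p l) hdz
    rw [cofreeVal_map, map_zero, Prod.mk_eq_zero] at hz'
    rw [cofreeVal_d 0 p j p l (by simp [hl]), map_zero, cofreeOp_zero, Prod.mk_eq_zero] at hdz'
    refine ⟨cofreeMk p i _ hmem, cofreeVal_injective p i ?_, cofreeVal_injective p j ?_⟩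
    · rw [cofreeVal_map, cofreeVal_mk, map_zero, map_zero]
      exact Prod.ext rfl hz'.1
    · rw [cofreeVal_d 0 p i p j (by simp [hi]), cofreeOp_zero, cofreeVal_mk, map_zero, zero_add]
      exact Prod.ext rfl (eq_neg_of_add_eq_zero_right hdz'.1).symm

/-! ### Maps into the cofree twisted complex -/

section Lift

variable {A : TwistedComplex k} (g : ∀ p q, A.X p q →ₗ[k] N)

/-- The function `w ↦ g(w x)`. -/
def wordEvalAt : List ℕ → ∀ p q, A.X p q →ₗ[k] N
  | [], p, q => g p q
  | n :: w, p, q => wordEvalAt w (p - (n + 1 : ℕ)) (q + (n + 1 : ℕ) - 1) ∘ₗ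
      (A.d (n + 1) p q (p - (n + 1 : ℕ)) (q + (n + 1 : ℕ) - 1)).hom

/-- The function `w ↦ g(w x)`. -/
def wordEval (p q : ℤ) : A.X p q →ₗ[k] (List ℕ → N) := LinearMap.pi fun w => wordEvalAt g w p q

theorem wordEval_d_succ (n : ℕ) (p q p' q' : ℤ)
    (h : p' + (n + 1 : ℕ) = p ∧ q' + 1 = q + (n + 1 : ℕ))
    (x : A.X p q) :
    wordEval g p' q' (A.d (n + 1) p q p' q' x) = preCons k N n (wordEval g p q x) := by
  obtain rfl : p' = p - (n + 1 : ℕ) := by lia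
  obtain rfl : q' = q + (n + 1 : ℕ) - 1 := by lia
  rfl

theorem wordEval_apply_eq_zero (p q : ℤ) (x : A.X p q) (w : List ℕ) (hw : p < wordWeight w) :
    wordEval g p q x w = 0 := by
  induction w generalizing p q with
  | nil =>
    have := ModuleCat.subsingleton_of_isZero (A.isZero_of_neg p q hw)
    rw [Subsingleton.elim x 0, map_zero]
    rfl
  | cons n w ih =>
    exact ih _ _ _ (by simp only [wordWeight] at hw; push_cast at hw ⊢; lia)

/-- The relation of degree `n + 1` in `A`, read on functions of words. The bidegrees are free
variables constrained by equations, which avoids transport along equalities of integers. -/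
theorem wordEval_relation (n : ℕ) (p q p₁ q₁ q₂ p₃ q₃ : ℤ) (hp₁ : p₁ + (n + 1 : ℕ) = p)
    (hq₁ : q₁ + 1 = q + (n + 1 : ℕ)) (hq₂ : q₂ + 1 = q) (hp₃ : p₃ = p₁) (hq₃ : q₃ + 1 = q₁)
    (x : A.X p q) :
    wordEval g p₃ q₃ (A.d 0 p₁ q₁ p₃ q₃ (A.d (n + 1) p q p₁ q₁ x)) +
      wordEval g p₃ q₃ (A.d (n + 1) p q₂ p₃ q₃ (A.d 0 p q p q₂ x)) +
      innerOp k N n (wordEval g p q x) = 0 := by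
  have h := congrArg (fun F => wordEval g p₃ q₃ (F.hom x)) (A.sum_d_comp_d (n + 1) p q p₃ q₃)
  rw [ModuleCat.hom_sum, LinearMap.sum_apply, map_sum] at h
  have h' := (sum_antidiagonal_succ_eq_innerSum (fun i j => wordEval g p₃ q₃
    ((A.d j p q (p - j) (q + j - 1) ≫ A.d i (p - j) (q + j - 1) p₃ q₃).hom x)) n).symm.trans
      (h.trans (map_zero _))
  rw [A.d_comp_d_congr (i := 0) (j := n + 1) (show p - ((n + 1 : ℕ) : ℤ) = p₁ by lia)
      (show q + ((n + 1 : ℕ) : ℤ) - 1 = q₁ by lia),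
    A.d_comp_d_congr (i := n + 1) (j := 0) (show p - ((0 : ℕ) : ℤ) = p by simp)
      (show q + ((0 : ℕ) : ℤ) - 1 = q₂ by lia)] at h'
  refine Eq.trans (congrArg₂ (· + ·) rfl ?_) h'
  rw [innerOp_apply]
  refine innerSum_congr fun i j hij => ?_
  refine Eq.symm ((wordEval_d_succ g i _ _ p₃ q₃ (by lia) _).trans ?_)
  exact congrArg (preCons k N i) (wordEval_d_succ g j p q _ _ (by lia) x)

/-- The second component of the map to the cofree twisted complex. -/
def wordEvalBoundary (p q : ℤ) : A.X p q →ₗ[k] (List ℕ → N) :=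
  wordEval g p (q - 1) ∘ₗ (A.d 0 p q p (q - 1)).hom - delta k N ∘ₗ wordEval g p q

theorem wordEvalBoundary_apply (p q q' : ℤ) (hq : q' + 1 = q) (x : A.X p q) :
    wordEvalBoundary g p q x =
      wordEval g p q' (A.d 0 p q p q' x) - delta k N (wordEval g p q x) := by
  obtain rfl : q' = q - 1 := by lia
  rfl

/-- The map to the cofree twisted complex induced by a family of linear maps. -/
def cofreeLift : A ⟶ cofree k N :=
  toCofree (fun p q => LinearMap.prod (wordEval g p q) (wordEvalBoundary g p q))
    (fun p q x w hw => by
      refine ⟨wordEval_apply_eq_zero g p q x w hw, ?_⟩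
      have h₁ := wordEval_apply_eq_zero g p (q - 1) (A.d 0 p q p (q - 1) x) w hw
      have h₂ : delta k N (wordEval g p q x) w = 0 :=
        delta_apply_eq_zero _ _ fun w' hw' => wordEval_apply_eq_zero g p q x w' (by rwa [hw'])
      exact (congrArg₂ (· - ·) h₁ h₂).trans (sub_zero _))
    (fun i p q p' q' x h => by
      change cofreeOp k N i (wordEval g p q x, wordEvalBoundary g p q x) =
        (wordEval g p' q' (A.d i p q p' q' x), wordEvalBoundary g p' q' (A.d i p q p' q' x))
      cases i with
      | zero =>
        obtain rfl : p' = p := by simpa using h.1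
        have hq : q' + 1 = q := by simpa using h.2
        rw [cofreeOp_zero, wordEvalBoundary_apply g p' q q' hq,
          wordEvalBoundary_apply g p' q' (q' - 1) (by lia), d_zero_d_zero]
        simp [delta_delta]
      | succ n =>
        rw [cofreeOp_succ, wordEval_d_succ g n p q p' q' h,
          wordEvalBoundary_apply g p q (q - 1) (by lia),
          wordEvalBoundary_apply g p' q' (q' - 1) (by lia), wordEval_d_succ g n p q p' q' h]
        refine Prod.ext rfl ?_
        have e := wordEval_relation g n p q p' q' (q - 1) p' (q' - 1) h.1 h.2 (by lia) rfl
          (by lia) x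
        rw [wordEval_d_succ g n p (q - 1) p' (q' - 1) (by lia)] at e
        simp only [map_sub, preCons_delta]
        rw [add_assoc] at e
        rw [eq_neg_of_add_eq_zero_left e]
        abel)

theorem cofreeVal_lift (p q : ℤ) (x : A.X p q) :
    (cofreeVal k N p q ((cofreeLift g).f p q x)).1 [] = g p q x :=
  rfl

end Lift

/-! ### Injectivity of cofibrations and projectivity of cofibrant objects -/

variable (k) in
/-- The product of all components of a twisted complex. -/
abbrev allComponents (A : TwistedComplex k) : Type u :=
  ∀ pq : ℤ × ℤ, A.X pq.1 pq.2

open Classical in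
/-- The inclusion of a component in the product of all components. -/
def toAllComponents (A : TwistedComplex k) (p q : ℤ) : A.X p q →ₗ[k] allComponents k A :=
  LinearMap.single k (fun pq : ℤ × ℤ => A.X pq.1 pq.2) (p, q)

theorem toAllComponents_apply_self (A : TwistedComplex k) (p q : ℤ) (x : A.X p q) :
    toAllComponents A p q x (p, q) = x := by
  classical
  exact Pi.single_eq_same (M := fun pq : ℤ × ℤ => A.X pq.1 pq.2) (p, q) x

theorem toAllComponents_injective (A : TwistedComplex k) (p q : ℤ) :
    Function.Injective (toAllComponents A p q) := fun x y h => by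
  rw [← toAllComponents_apply_self A p q x, h, toAllComponents_apply_self]

/-- A morphism with the left lifting property with respect to `I.rlp` is injective. -/
theorem mono_of_llp {A B : TwistedComplex k} (i : A ⟶ B)
    (hi : (generatingCofibrations k).rlp.llp i) : Mono i := by
  -- The cofree complex on `allComponents k A` maps to a zero object by a map in `I.rlp`, so the
  -- canonical map from `A` extends along `i`. Its value at the empty word recovers each component
  -- of `A`.
  have hz : Function.Surjective (0 : allComponents k A →ₗ[k] PUnit.{u + 1}) :=
    fun _ => ⟨0, Subsingleton.elim _ _⟩
  have := hi _ (cofreeMap_rlp (k := k) _ hz)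
  have hsq (F G : A ⟶ cofree k PUnit.{u + 1}) : F = G :=
    hom_ext fun p q => ModuleCat.hom_ext (LinearMap.ext fun x =>
      cofreeVal_injective p q (Subsingleton.elim _ _))
  have sq : CommSq (cofreeLift (toAllComponents A)) i
      (cofreeMap (k := k) (0 : allComponents k A →ₗ[k] PUnit.{u + 1})) (cofreeLift fun _ _ => 0) :=
    ⟨hsq _ _⟩
  rw [mono_iff_injective]
  intro p q x y hxy
  refine toAllComponents_injective A p q ?_
  rw [← cofreeVal_lift (toAllComponents A), ← cofreeVal_lift (toAllComponents A), ← sq.fac_left]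
  change (cofreeVal k _ p q (sq.lift.f p q (i.f p q x))).1 [] =
    (cofreeVal k _ p q (sq.lift.f p q (i.f p q y))).1 []
  rw [hxy]

/-- A twisted complex `A` such that `0 ⟶ A` has the left lifting property with respect to `I.rlp`
is projective in each bidegree. -/
theorem projective_of_llp {Z A : TwistedComplex k} (hZ : IsZero Z) (i : Z ⟶ A)
    (hi : (generatingCofibrations k).rlp.llp i) (p q : ℤ) : Module.Projective k (A.X p q) := by
  -- Lifting the canonical map through the free module on the elements of the product exhibits each
  -- `A.X p q` as a direct summand of that free module.
  let F : (allComponents k A →₀ k) →ₗ[k] allComponents k A := Finsupp.linearCombination k id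
  have hF : Function.Surjective F := Finsupp.linearCombination_id_surjective k _
  have := hi _ (cofreeMap_rlp F hF)
  have sq : CommSq (hZ.to_ _) i (cofreeMap F) (cofreeLift (toAllComponents A)) :=
    ⟨hZ.eq_of_src _ _⟩
  let h : A.X p q →ₗ[k] (allComponents k A →₀ k) :=
    LinearMap.proj [] ∘ₗ LinearMap.fst k _ _ ∘ₗ cofreeVal k _ p q ∘ₗ (sq.lift.f p q).hom
  have hh (x : A.X p q) : F (h x) = toAllComponents A p q x := by
    rw [← cofreeVal_lift (toAllComponents A), ← sq.fac_right]
    rfl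
  refine Module.Projective.of_split h
    (LinearMap.proj (R := k) (φ := fun pq : ℤ × ℤ => A.X pq.1 pq.2) (p, q) ∘ₗ F) ?_
  refine LinearMap.ext fun x => ?_
  exact (congrFun (hh x) _).trans (toAllComponents_apply_self A p q x)

end Cofree

end TwistedComplex

namespace TwistedComplex

variable {k : Type u} [CommRing k]

/-! ### The path object of a twisted complex over its total complex -/

section Path

variable (A : TwistedComplex k)

/-- The inclusion of `A_{p,q}` in the total complex in degree `n` if `p + q = n`, otherwise zero. -/
def toTot (p q n : ℤ) : A.X p q →ₗ[k] A.TotX n :=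
  if h : (p.toNat : ℤ) = p ∧ q = n - p.toNat then
    A.totι n p.toNat ∘ₗ
      (eqToHom (by rw [h.1, h.2]; simp [h.1]) : A.X p q ⟶ A.X p.toNat (n - p.toNat)).hom
  else 0

theorem toTot_self (p : ℕ) (n : ℤ) : A.toTot p (n - p) n = A.totι n p :=
  dif_pos ⟨rfl, rfl⟩

theorem toTot_d (i : ℕ) (p₀ q₀ p q n : ℤ) (r : ℕ) (hp : p = r) (hq : q = n - r) (x : A.X p₀ q₀) :
    A.toTot p q n (A.d i p₀ q₀ p q x) = A.totι n r (A.d i p₀ q₀ r (n - r) x) := by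
  subst hp hq
  rw [toTot_self]

theorem totD_toTot (p : ℕ) (q n m : ℤ) (hn : p + q = n) (hm : m + 1 = n) (x : A.X p q) :
    A.totD n m (A.toTot p q n x) = ∑ ij ∈ Finset.HasAntidiagonal.antidiagonal p,
      A.toTot (p - ij.2) (q + ij.2 - 1) m (A.d ij.2 p q (p - ij.2) (q + ij.2 - 1) x) := by
  obtain rfl : q = n - p := by lia
  rw [toTot_self, totD_lof, ← Finset.Nat.sum_antidiagonal_swap]
  refine Finset.sum_congr rfl ?_
  rintro ⟨i, j⟩ hij
  rw [Finset.HasAntidiagonal.mem_antidiagonal] at hij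
  dsimp only [Prod.swap_prod_mk] at hij ⊢
  exact (A.toTot_d _ _ _ _ _ _ _ (by lia) (by lia) _).symm

open Classical in
/-- The submodule of `Tot_{q+1}` used in bidegree `(p,q)`: everything in column zero. -/
def pathSubmodule (p q : ℤ) : Submodule k (A.TotX (q + 1)) := if p = 0 then ⊤ else ⊥

theorem mem_pathSubmodule_iff (p q : ℤ) (t : A.TotX (q + 1)) :
    t ∈ A.pathSubmodule p q ↔ (p ≠ 0 → t = 0) := by
  unfold pathSubmodule
  by_cases h : p = 0 <;> simp [h]

/-- The module of pairs `(c, t)`, `c ∈ A_{p,q}`, `t ∈ Tot_{q+1}`, with `t = 0` outside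
column zero. -/
abbrev PathX (p q : ℤ) : Type u := A.X p q × A.pathSubmodule p q

open Classical in
/-- The second component `ι c - D t` of the differentials. -/
def pathMap (i : ℕ) (p q p' q' : ℤ) : A.PathX p q →ₗ[k] A.TotX (q' + 1) :=
  -- Only components into column zero carry a `Tot` part; then `q' + 1 = p + q`, the total degree of
  -- the source.
  if p' + i = p ∧ q' + 1 = q + i ∧ p' = 0 then
    A.toTot p q (q' + 1) ∘ₗ LinearMap.fst k _ _ -
      A.totD (q + 1) (q' + 1) ∘ₗ (A.pathSubmodule p q).subtype ∘ₗ LinearMap.snd k _ _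
  else 0

theorem pathMap_mem (i : ℕ) (p q p' q' : ℤ) (x : A.PathX p q) :
    A.pathMap i p q p' q' x ∈ A.pathSubmodule p' q' := by
  rw [mem_pathSubmodule_iff]
  intro h
  rw [pathMap, if_neg (by tauto)]
  rfl

theorem pathMap_apply (i : ℕ) (p q p' q' : ℤ) (h : p' + i = p ∧ q' + 1 = q + i ∧ p' = 0)
    (x : A.PathX p q) : A.pathMap i p q p' q' x =
      A.toTot p q (q' + 1) x.1 - A.totD (q + 1) (q' + 1) x.2.1 := by
  rw [pathMap, if_pos h]
  rfl

theorem pathMap_eq_zero (i : ℕ) (p q p' q' : ℤ)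
    (h : ¬ (p' + i = p ∧ q' + 1 = q + i ∧ p' = 0)) : A.pathMap i p q p' q' = 0 :=
  if_neg h

/-- The differentials of the path object. -/
def pathD (i : ℕ) (p q p' q' : ℤ) : A.PathX p q →ₗ[k] A.PathX p' q' :=
  LinearMap.prod ((A.d i p q p' q').hom ∘ₗ LinearMap.fst k _ _)
    ((A.pathMap i p q p' q').codRestrict (A.pathSubmodule p' q') (A.pathMap_mem i p q p' q'))

/-- The terms `ι(d_j c)` add up to `D(ι c)`. Of the terms `D(…)` only the one with `i = 0` survives,
since only there is the intermediate column zero; it contributes `D(ι c - D t) = D(ι c)`. -/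
theorem sum_pathD (n : ℕ) (p q p'' q'' : ℤ) (x : A.PathX p q) :
    ∑ ij ∈ Finset.HasAntidiagonal.antidiagonal n,
      A.pathMap ij.1 (p - ij.2) (q + ij.2 - 1) p'' q''
        (A.pathD ij.2 p q (p - ij.2) (q + ij.2 - 1) x) = 0 := by
  by_cases h : p'' + n = p ∧ q'' + 2 = q + n ∧ p'' = 0
  · obtain ⟨h₁, h₂, rfl⟩ := h
    obtain rfl : p = n := by lia
    have e : ∀ ij ∈ Finset.HasAntidiagonal.antidiagonal n,
        A.pathMap ij.1 (n - ij.2) (q + ij.2 - 1) 0 q''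
          (A.pathD ij.2 n q (n - ij.2) (q + ij.2 - 1) x) =
        A.toTot (n - ij.2) (q + ij.2 - 1) (q'' + 1)
          (A.d ij.2 n q (n - ij.2) (q + ij.2 - 1) x.1) -
        A.totD (q + ij.2 - 1 + 1) (q'' + 1)
          (A.pathMap ij.2 n q (n - ij.2) (q + ij.2 - 1) x) := fun ij hij => by
      rw [Finset.HasAntidiagonal.mem_antidiagonal] at hij
      exact A.pathMap_apply _ _ _ _ _ (by lia) _
    rw [Finset.sum_congr rfl e, Finset.sum_sub_distrib,
      ← A.totD_toTot n q (q + n - 1 + 1) (q'' + 1) (by lia) (by lia),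
      Finset.sum_eq_single (0, n)]
    · dsimp only
      have h₀ : A.totD (q + n - 1 + 1) (q'' + 1) (A.totD (q + 1) (q + n - 1 + 1) x.2.1) = 0 := by
        rcases Nat.eq_zero_or_pos n with rfl | hn
        · exact A.totD_totD _ _ _ (by simp) _
        · rw [A.totD_eq_zero (q + 1) _ (by lia), LinearMap.zero_apply, map_zero]
      rw [A.pathMap_apply _ _ _ _ _ (by simp), map_sub, h₀, sub_zero, sub_self]
    · rintro ⟨i, j⟩ h h'
      rw [Finset.HasAntidiagonal.mem_antidiagonal] at h
      have : i ≠ 0 := by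
        rintro rfl
        exact h' (Prod.ext rfl (by lia))
      rw [pathMap_eq_zero _ _ _ _ _ _ (by lia)]
      exact map_zero _
    · intro h
      exact absurd (Finset.HasAntidiagonal.mem_antidiagonal.2 (by simp)) h
  · refine Finset.sum_eq_zero fun ij hij => ?_
    rw [Finset.HasAntidiagonal.mem_antidiagonal] at hij
    rw [pathMap_eq_zero _ _ _ _ _ _ (by lia)]
    rfl

/-- The path object: `A` together with a contraction of its image in the total complex. -/
def path : TwistedComplex k where
  X p q := ModuleCat.of k (A.PathX p q)
  d i p q p' q' := ModuleCat.ofHom (A.pathD i p q p' q')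
  isZero_of_neg p q hp := by
    have : Subsingleton (A.X p q) := ModuleCat.subsingleton_of_isZero (A.isZero_of_neg p q hp)
    have : Subsingleton (A.pathSubmodule p q) := by
      rw [pathSubmodule, if_neg (by lia)]; infer_instance
    exact ModuleCat.isZero_of_subsingleton (ModuleCat.of k (A.PathX p q))
  shape i p q p' q' h := by
    refine ModuleCat.hom_ext (LinearMap.ext fun x => Prod.ext ?_ (Subtype.ext ?_))
    · change A.d i p q p' q' x.1 = 0
      rw [A.shape i p q p' q' h]
      rfl
    · change A.pathMap i p q p' q' x = 0
      rw [pathMap_eq_zero _ _ _ _ _ _ (by tauto)]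
      rfl
  sum_d_comp_d n p q p'' q'' := by
    refine ModuleCat.hom_ext (LinearMap.ext fun x => ?_)
    rw [ModuleCat.hom_sum, LinearMap.sum_apply]
    refine Prod.ext ?_ (Subtype.ext ?_)
    · refine (map_sum (LinearMap.fst k (A.X p'' q'') (A.pathSubmodule p'' q'')) _ _).trans ?_
      have := congrArg (fun F => F.hom x.1) (A.sum_d_comp_d n p q p'' q'')
      rw [ModuleCat.hom_sum, LinearMap.sum_apply] at this
      exact this
    · refine (map_sum ((A.pathSubmodule p'' q'').subtype ∘ₗ
        LinearMap.snd k (A.X p'' q'') (A.pathSubmodule p'' q'')) _ _).trans ?_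
      exact A.sum_pathD n p q p'' q'' x

/-- The projection of the path object. -/
def pathπ : A.path ⟶ A where
  f p q := ModuleCat.ofHom (LinearMap.fst k (A.X p q) (A.pathSubmodule p q))
  comm _ _ _ _ _ := rfl

/-- The kernel is concentrated in column zero, where `J.rlp` imposes no acyclicity. -/
theorem pathπ_rlp : (generatingTrivialCofibrations k).rlp A.pathπ := by
  rw [generatingTrivialCofibrations_rlp_iff, epi_iff_surjective]
  refine ⟨fun p q c => ⟨((c, 0) : A.PathX p q), rfl⟩, fun p hp => ?_⟩
  rw [vertical_kernel_acyclic_iff]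
  intro i j l _ _ z hz _
  refine ⟨0, map_zero _, (map_zero _).trans (Eq.symm ?_)⟩
  exact Prod.ext (y := (0 : A.PathX p j)) hz
    (Subtype.ext ((A.mem_pathSubmodule_iff p j _).1 z.2.2 hp.ne'))

variable {A}

/-- The second component of a section is a family `s : A_{0,q} → Tot_{q+1}` with `s(d_p x) = ι x -
D(s x)`, where `s` is zero on columns `p > 0`. As `d_p x` is the column-zero part of `D(ι x)`,
projecting to column zero and applying `s` is a contracting homotopy of `Tot A`. -/
theorem Tot_acyclic_of_section (σ : A ⟶ A.path) (hσ : σ ≫ A.pathπ = 𝟙 A) :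
    (Tot.obj A).Acyclic := by
  let s (p q : ℤ) : A.X p q →ₗ[k] A.TotX (q + 1) :=
    (A.pathSubmodule p q).subtype ∘ₗ LinearMap.snd k (A.X p q) (A.pathSubmodule p q) ∘ₗ
      (σ.f p q).hom
  have hs (p q : ℤ) (hp : p ≠ 0) (x : A.X p q) : s p q x = 0 :=
    (A.mem_pathSubmodule_iff p q _).1 (Subtype.property _) hp
  have hsd (i : ℕ) (p q p' q' : ℤ) (h : p' + i = p ∧ q' + 1 = q + i ∧ p' = 0) (x : A.X p q) :
      s p' q' (A.d i p q p' q' x) =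
        A.toTot p q (q' + 1) x - A.totD (q + 1) (q' + 1) (s p q x) := by
    refine (congrArg (fun y : A.PathX p' q' => y.2.1) (comm_apply σ i p q p' q' x)).symm.trans ?_
    refine (A.pathMap_apply i p q p' q' h _).trans ?_
    have : (pathπ A).f p q (σ.f p q x) = x := congrArg (fun F : A ⟶ A => F.f p q x) hσ
    exact congrArg₂ (· - ·) (congrArg (A.toTot p q (q' + 1)) this) rfl
  rw [Tot_acyclic_iff]
  intro i j l hi hl z hz
  -- The column-zero summand of `Tot_n` is literally `A.X 0 (n - 0)`; writing the degrees in this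
  -- form makes the types agree definitionally.
  obtain rfl : j = l - (0 : ℕ) + 1 := by simp [hl]
  obtain rfl : i = l - (0 : ℕ) + 1 - (0 : ℕ) + 1 := by lia
  refine ⟨s (0 : ℕ) _ (z 0), ?_⟩
  have key : s (0 : ℕ) (l - (0 : ℕ)) ∘ₗ DirectSum.component k ℕ (fun p : ℕ => A.X p (l - p)) 0 ∘ₗ
      A.totD (l - (0 : ℕ) + 1) l = LinearMap.id -
        A.totD (l - (0 : ℕ) + 1 - (0 : ℕ) + 1) (l - (0 : ℕ) + 1) ∘ₗ
          s (0 : ℕ) (l - (0 : ℕ) + 1 - (0 : ℕ)) ∘ₗ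
            DirectSum.component k ℕ (fun p : ℕ => A.X p (l - (0 : ℕ) + 1 - p)) 0 := by
    refine DirectSum.linearMap_ext k fun p => LinearMap.ext fun x => ?_
    change s (0 : ℕ) (l - (0 : ℕ)) (A.totD (l - (0 : ℕ) + 1) l (A.totι _ p x) 0) =
      A.totι _ p x - A.totD _ _ (s (0 : ℕ) _ (A.totι _ p x 0))
    rw [totD_totι_apply _ _ _ _ _ _ (Nat.zero_le p), Nat.sub_zero, hsd _ _ _ _ _ (by lia),
      toTot_self]
    refine congrArg₂ (· - ·) rfl ?_
    rcases Nat.eq_zero_or_pos p with rfl | hp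
    · rw [totι_apply_self]
    · rw [totι_apply_of_ne _ _ hp.ne', hs _ _ (by lia), map_zero, map_zero, map_zero]
  have := LinearMap.congr_fun key z
  change s (0 : ℕ) (l - (0 : ℕ)) (A.totD (l - (0 : ℕ) + 1) l z 0) =
    z - A.totD _ _ (s (0 : ℕ) _ (z 0)) at this
  rw [hz] at this
  exact (sub_eq_zero.1 (this.symm.trans (map_zero _))).symm

end Path

/-! ### Maps with the left lifting property against fibrations -/

variable {A B : TwistedComplex k}

theorem Tot_acyclic_of_llp {Z : TwistedComplex k} (hZ : IsZero Z) (i : Z ⟶ A)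
    (hi : (generatingTrivialCofibrations k).rlp.llp i) : (Tot.obj A).Acyclic := by
  have := hi _ A.pathπ_rlp
  have sq : CommSq (hZ.to_ _) i A.pathπ (𝟙 A) := ⟨hZ.eq_of_src _ _⟩
  exact Tot_acyclic_of_section sq.lift sq.fac_right

theorem llp_rlp_generatingTrivialCofibrations_le :
    (generatingTrivialCofibrations k).rlp.llp ≤ (generatingCofibrations k).rlp.llp :=
  MorphismProperty.antitone_llp fun _ _ F hF => ((generatingCofibrations_rlp_iff_quasiIso F).1 hF).1

theorem isPushout_cokernel (F : A ⟶ B) :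
    IsPushout F (0 : A ⟶ zero k) (cokernel.π F) 0 where
  w := (cokernel.condition F).trans zero_comp.symm
  isColimit' := ⟨PushoutCocone.IsColimit.mk _ (fun s => cokernel.desc F s.inl
      (s.condition.trans ((congrArg (0 ≫ ·) ((isZero_zero k).eq_of_src _ 0)).trans comp_zero)))
    (fun s => cokernel.π_desc _ _ _) (fun s => (isZero_zero k).eq_of_src _ _)
    (fun s m h _ => by rw [← cancel_epi (cokernel.π F), h, cokernel.π_desc])⟩

/-- Such a map is injective, so its cokernel decides. The map from zero to the cokernel is a pushout
of `F`, so it has the same lifting property and the path object applies. -/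
theorem quasiIso_Tot_of_llp (F : A ⟶ B) (hF : (generatingTrivialCofibrations k).rlp.llp F) :
    QuasiIso (Tot.map F) := by
  have := mono_of_llp F (llp_rlp_generatingTrivialCofibrations_le _ hF)
  rw [quasiIso_Tot_iff_cokernel]
  exact Tot_acyclic_of_llp (isZero_zero k) _
    (MorphismProperty.of_isPushout (isPushout_cokernel F).flip hF)

/-- A vertical cycle of the target lifts to a vertical cycle: this is the disc lifting property one
degree lower with zero prescribed boundary, available since `p > 0`. -/
theorem boundary_llp (p q : ℤ) (hp : 0 < p) :
    (generatingTrivialCofibrations k).rlp.llp (0 : zero k ⟶ boundary k p q) := by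
  intro U V F hF
  rw [generatingTrivialCofibrations_rlp_iff, epi_iff_surjective] at hF
  have h := (liftsDiscs_iff F p).2 ⟨hF.1 p, hF.2 p hp⟩
  refine ⟨fun {a b} sq => ⟨⟨?_⟩⟩⟩
  have := h (q - 1) (b.f p (q - 1) (cyclicGen {[0]} p (q - 1))) 0 (map_zero _) (by
    rw [map_zero]
    refine Eq.symm ((comm_apply b _ _ _ _ _ _).trans ?_)
    exact (congrArg _ (d_zero_boundary_gen p q)).trans (map_zero _))
  refine ⟨boundaryDesc p q this.choose this.choose_spec.1, (isZero_zero k).eq_of_src _ _,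
    cyclic_hom_ext ?_⟩
  exact (congrArg (F.f p (q - 1)) (boundaryDesc_gen p q _ _)).trans this.choose_spec.2

theorem Tot_boundary_acyclic (p q : ℤ) (hp : 0 < p) :
    (Tot.obj (boundary k p q)).Acyclic :=
  Tot_acyclic_of_llp (isZero_zero k) _ (boundary_llp p q hp)

/-- Generating cofibrations are cofibrations, hence injective; no basis of the disc or of its
boundary is computed. -/
theorem boundaryInclusion_injective (p q : ℤ) (hp : 0 ≤ p) (a b : ℤ) :
    Function.Injective ((boundaryInclusion k p q).f a b) := by
  obtain ⟨p, rfl⟩ := Int.eq_ofNat_of_zero_le hp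
  exact (mono_iff_injective _).1 (mono_of_llp _ (MorphismProperty.le_llp_rlp _ _
    (MorphismProperty.ofHoms.mk (p, q)))) a b

end TwistedComplex

/-! ### Pullback squares of cokernels -/

namespace CategoryTheory.Abelian

universe v w

variable {C : Type w} [Category.{v} C] [Abelian C] {A B E : C}

/-- If `i = s ≫ r` is a monomorphism, the square formed by `r` and the induced map on cokernels is
a pullback square. -/
theorem isPullback_cokernel_map {s : A ⟶ E} {r : E ⟶ B} {i : A ⟶ B} (h : s ≫ r = i) [Mono i] :
    IsPullback r (cokernel.π s) (cokernel.π i)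
      (cokernel.map s i (𝟙 A) r (by rw [h, Category.id_comp])) := by
  have : Mono s := by
    have : Mono (s ≫ r) := by rwa [h]
    exact mono_of_mono s r
  have w : r ≫ cokernel.π i = cokernel.π s ≫
      cokernel.map s i (𝟙 A) r (by rw [h, Category.id_comp]) := by simp
  let φ := pullback.lift r (cokernel.π s) w
  have : Mono φ := by
    rw [Preadditive.mono_iff_cancel_zero]
    intro T x hx
    have h₁ : x ≫ r = 0 := by
      rw [← pullback.lift_fst r (cokernel.π s) w, ← Category.assoc]
      exact (congrArg (· ≫ _) hx).trans zero_comp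
    have h₂ : x ≫ cokernel.π s = 0 := by
      rw [← pullback.lift_snd r (cokernel.π s) w, ← Category.assoc]
      exact (congrArg (· ≫ _) hx).trans zero_comp
    have e := monoLift_comp s x h₂
    rw [← e, Category.assoc, h] at h₁
    rw [← e, zero_of_comp_mono i h₁, zero_comp]
  have : Epi φ := by
    rw [epi_iff_surjective_up_to_refinements]
    intro T z
    obtain ⟨T', π, hπ, e, he⟩ :=
      surjective_up_to_refinements_of_epi (cokernel.π s) (z ≫ pullback.snd _ _)
    -- A lift `e` of the cokernel coordinate has the right image in `B` up to an element of `A`,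
    -- which corrects `e` through `s`.
    have h₀ : (π ≫ z ≫ pullback.fst _ _ - e ≫ r) ≫ cokernel.π i = 0 := by
      rw [Preadditive.sub_comp, Category.assoc, Category.assoc, Category.assoc, w,
        ← Category.assoc e, ← he, pullback.condition, Category.assoc, Category.assoc, sub_self]
    have h₁ := monoLift_comp i _ h₀
    refine ⟨T', π, hπ, e + monoLift i _ h₀ ≫ s, pullback.hom_ext ?_ ?_⟩
    · rw [Category.assoc, Category.assoc, pullback.lift_fst, Preadditive.add_comp, Category.assoc]
      have h₂ : monoLift i _ h₀ ≫ s ≫ r = _ := (congrArg (_ ≫ ·) h).trans h₁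
      rw [h₂, add_sub_cancel]
    · rw [Category.assoc, Category.assoc, pullback.lift_snd, Preadditive.add_comp, Category.assoc,
        cokernel.condition, comp_zero, add_zero, he]
  have : IsIso φ := isIso_of_mono_of_epi φ
  exact IsPullback.of_iso_pullback ⟨w⟩ (asIso φ) (pullback.lift_fst _ _ _) (pullback.lift_snd _ _ _)

end CategoryTheory.Abelian

namespace TwistedComplex

/-! ### Isomorphism invariance and maps to or from zero objects -/

variable {k : Type u} [CommRing k] {A B : TwistedComplex k}

theorem acyclic_obj_iff_of_iso (F : TwistedComplex k ⥤ ChainComplex (ModuleCat.{u} k) ℤ)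
    (e : A ≅ B) : (F.obj A).Acyclic ↔ (F.obj B).Acyclic :=
  ⟨fun h n => (h n).of_iso (F.mapIso e), fun h n => (h n).of_iso (F.mapIso e.symm)⟩

/-- The kernel of a map to a zero object. -/
def kernelIsoOfIsZero (F : A ⟶ B) (hB : IsZero B) : kernel F ≅ A :=
  kernelIsoOfEq (hB.eq_of_tgt F 0) ≪≫ kernelZeroIsoSource

/-- The cokernel of a map from a zero object. -/
def cokernelIsoOfIsZero (F : A ⟶ B) (hA : IsZero A) : cokernel F ≅ B :=
  cokernelIsoOfEq (hA.eq_of_src F 0) ≪≫ cokernelZeroIsoTarget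

theorem quasiIso_Tot_iff_of_isZero_source (F : A ⟶ B) (hA : IsZero A) :
    QuasiIso (Tot.map F) ↔ (Tot.obj B).Acyclic := by
  have : Mono F := ⟨fun _ _ _ => hA.eq_of_tgt _ _⟩
  rw [quasiIso_Tot_iff_cokernel, acyclic_obj_iff_of_iso Tot (cokernelIsoOfIsZero F hA)]

theorem quasiIso_Tot_iff_of_isZero_target (F : A ⟶ B) (hB : IsZero B) :
    QuasiIso (Tot.map F) ↔ (Tot.obj A).Acyclic := by
  have : Epi F := ⟨fun _ _ _ => hB.eq_of_src _ _⟩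
  rw [quasiIso_Tot_iff_kernel, acyclic_obj_iff_of_iso Tot (kernelIsoOfIsZero F hB)]

theorem generatingTrivialCofibrations_rlp_iff_of_isZero (F : A ⟶ B) (hB : IsZero B) :
    (generatingTrivialCofibrations k).rlp F ↔
      ∀ p : ℤ, 0 < p → ((vertical p).obj A).Acyclic := by
  have : Epi F := ⟨fun _ _ _ => hB.eq_of_src _ _⟩
  rw [generatingTrivialCofibrations_rlp_iff]
  simp only [this, true_and, acyclic_obj_iff_of_iso _ (kernelIsoOfIsZero F hB)]

/-! ### Cofibrations -/

/-- Factor `i` as a cofibration followed by a map in `I.rlp`. By the pullback square of cokernels,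
the induced map `r` on cokernels has the same kernel and is again in `I.rlp`. It thus has a section,
which the pullback turns into a section of the second factor under `A`, so `i` is a retract of the
first factor. -/
theorem llp_of_mono (i : A ⟶ B) [Mono i] {Z : TwistedComplex k} (hZ : IsZero Z)
    (j : Z ⟶ cokernel i) (hj : (generatingCofibrations k).rlp.llp j) :
    (generatingCofibrations k).rlp.llp i := by
  have f := MorphismProperty.factorizationData (generatingCofibrations k).rlp.llp
    (generatingCofibrations k).rlp i
  have sq := Abelian.isPullback_cokernel_map f.fac
  obtain ⟨_, hk⟩ := (generatingCofibrations_rlp_iff f.p).1 f.hp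
  set r := cokernel.map f.i i (𝟙 A) f.p (by rw [f.fac, Category.id_comp]) with hr
  have hr' : (generatingCofibrations k).rlp r := by
    rw [generatingCofibrations_rlp_iff]
    have := isIso_kernel_map_of_isPullback sq
    refine ⟨?_, fun p hp =>
      (acyclic_obj_iff_of_iso _ (asIso (kernel.map _ _ _ _ sq.w))).1 (hk p hp)⟩
    have : Epi (cokernel.π f.i ≫ r) := by
      rw [← sq.w]
      infer_instance
    exact epi_of_epi (cokernel.π f.i) r
  have := hj _ hr'
  have sq' : CommSq (hZ.to_ _) j r (𝟙 (cokernel i)) := ⟨hZ.eq_of_src _ _⟩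
  let σ : B ⟶ f.Z := sq.lift (𝟙 B) (cokernel.π i ≫ sq'.lift) (by
    rw [Category.id_comp, Category.assoc, sq'.fac_right, Category.comp_id])
  have hσ : i ≫ σ = f.i := sq.hom_ext
    (by rw [Category.assoc, sq.lift_fst, Category.comp_id, f.fac])
    (by rw [Category.assoc, sq.lift_snd, ← Category.assoc, cokernel.condition, zero_comp,
      cokernel.condition])
  refine MorphismProperty.of_retract (f := i) (g := f.i) ?_ f.hi
  exact
    { i := Arrow.homMk (𝟙 A) σ ((Category.id_comp _).trans hσ.symm)
      r := Arrow.homMk (𝟙 A) f.p ((Category.id_comp _).trans f.fac.symm)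
      retract := Arrow.hom_ext _ _ (Category.comp_id (𝟙 A)) (sq.lift_fst _ _ _) }

/-! ### Pullbacks and pushouts of quasi-isomorphisms of total complexes -/

section Square

variable {X₁ X₂ X₃ X₄ : TwistedComplex k} {t : X₁ ⟶ X₂} {l : X₁ ⟶ X₃} {r : X₂ ⟶ X₄} {b : X₃ ⟶ X₄}

/-- Here `t` is again a monomorphism, and its cokernel is that of `b`: the comparison map is mono
because the square is a pullback and epi because `r` is. The lemma for pushouts is dual. -/
theorem quasiIso_Tot_of_isPullback (sq : IsPullback t l r b) [Epi r] [Mono b]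
    (hb : QuasiIso (Tot.map b)) : QuasiIso (Tot.map t) := by
  have : Mono t := ⟨fun x y h => sq.hom_ext h ((cancel_mono b).1 (by
    rw [Category.assoc, Category.assoc, ← sq.w, ← Category.assoc, h, Category.assoc]))⟩
  have := Abelian.mono_cokernel_map_of_isPullback sq
  have : Epi (cokernel.map _ _ _ _ sq.w) := by
    have : Epi (cokernel.π t ≫ cokernel.map _ _ _ _ sq.w) := by
      rw [cokernel.π_desc]
      infer_instance
    exact epi_of_epi (cokernel.π t) _
  have := isIso_of_mono_of_epi (cokernel.map _ _ _ _ sq.w)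
  rw [quasiIso_Tot_iff_cokernel] at hb ⊢
  exact (acyclic_obj_iff_of_iso _ (asIso (cokernel.map _ _ _ _ sq.w))).2 hb

theorem quasiIso_Tot_of_isPushout (sq : IsPushout t l r b) [Epi t] [Mono l]
    (ht : QuasiIso (Tot.map t)) : QuasiIso (Tot.map b) := by
  have : Epi b := ⟨fun x y h => sq.hom_ext ((cancel_epi t).1 (by
    rw [← Category.assoc, ← Category.assoc, sq.w, Category.assoc, h, Category.assoc])) h⟩
  have := Abelian.epi_kernel_map_of_isPushout sq
  have : Mono (kernel.map _ _ _ _ sq.w) := by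
    have : Mono (kernel.map _ _ _ _ sq.w ≫ kernel.ι b) := by
      rw [kernel.lift_ι]
      infer_instance
    exact mono_of_mono _ (kernel.ι b)
  have := isIso_of_mono_of_epi (kernel.map _ _ _ _ sq.w)
  rw [quasiIso_Tot_iff_kernel] at ht ⊢
  exact (acyclic_obj_iff_of_iso _ (asIso (kernel.map _ _ _ _ sq.w))).1 ht

end Square

/-! ### The model structure -/

/-- The weak equivalences are the maps `F` such that `Tot F` is a quasi-isomorphism. -/
scoped instance : CategoryWithWeakEquivalences (TwistedComplex k) where
  weakEquivalences := (HomologicalComplex.quasiIso (ModuleCat.{u} k) _).inverseImage Tot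

scoped instance : CategoryWithFibrations (TwistedComplex k) where
  fibrations := (generatingTrivialCofibrations k).rlp

scoped instance : CategoryWithCofibrations (TwistedComplex k) where
  cofibrations := (generatingCofibrations k).rlp.llp

theorem weakEquivalence_iff_quasiIso (F : A ⟶ B) :
    WeakEquivalence F ↔ QuasiIso (Tot.map F) :=
  weakEquivalence_iff F

theorem fibration_iff_rlp (F : A ⟶ B) :
    Fibration F ↔ (generatingTrivialCofibrations k).rlp F :=
  fibration_iff F

theorem cofibration_iff_llp (F : A ⟶ B) :
    Cofibration F ↔ (generatingCofibrations k).rlp.llp F :=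
  cofibration_iff F

theorem trivialFibrations_eq :
    trivialFibrations (TwistedComplex k) = (generatingCofibrations k).rlp := by
  ext A B F
  rw [mem_trivialFibrations_iff, generatingCofibrations_rlp_iff_quasiIso, fibration_iff_rlp,
    weakEquivalence_iff_quasiIso]

scoped instance : (weakEquivalences (TwistedComplex k)).HasTwoOutOfThreeProperty :=
  inferInstanceAs ((HomologicalComplex.quasiIso (ModuleCat.{u} k) _).inverseImage
    Tot).HasTwoOutOfThreeProperty

/-- In the factorization of a trivial cofibration through `J.rlp.llp` and `J.rlp`, two-out-of-three
puts the second factor in `I.rlp`, so the map is a retract of the first factor. -/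
theorem trivialCofibrations_eq :
    trivialCofibrations (TwistedComplex k) = (generatingTrivialCofibrations k).rlp.llp := by
  ext A B F
  rw [mem_trivialCofibrations_iff, cofibration_iff_llp, weakEquivalence_iff_quasiIso]
  refine ⟨fun ⟨h₁, h₂⟩ => ?_, fun h =>
    ⟨llp_rlp_generatingTrivialCofibrations_le _ h, quasiIso_Tot_of_llp F h⟩⟩
  have f := MorphismProperty.factorizationData (generatingTrivialCofibrations k).rlp.llp
    (generatingTrivialCofibrations k).rlp F
  have : WeakEquivalence F := (weakEquivalence_iff_quasiIso F).2 h₂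
  have : WeakEquivalence f.i := (weakEquivalence_iff_quasiIso _).2 (quasiIso_Tot_of_llp _ f.hi)
  have : WeakEquivalence f.p := weakEquivalence_of_precomp_of_fac f.fac
  have := h₁ f.p ((generatingCofibrations_rlp_iff_quasiIso _).2
    ⟨f.hp, (weakEquivalence_iff_quasiIso _).1 this⟩)
  exact MorphismProperty.of_retract (RetractArrow.ofLeftLiftingProperty f.fac) f.hi

scoped instance : MorphismProperty.IsWeakFactorizationSystem (cofibrations (TwistedComplex k))
    (trivialFibrations (TwistedComplex k)) := by
  rw [trivialFibrations_eq]
  exact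
    { rlp := MorphismProperty.rlp_llp_rlp _
      llp := rfl
      hasFactorization := inferInstanceAs (MorphismProperty.HasFactorization
        (generatingCofibrations k).rlp.llp (generatingCofibrations k).rlp) }

scoped instance : MorphismProperty.IsWeakFactorizationSystem
    (trivialCofibrations (TwistedComplex k)) (fibrations (TwistedComplex k)) := by
  rw [trivialCofibrations_eq]
  exact
    { rlp := MorphismProperty.rlp_llp_rlp _
      llp := rfl
      hasFactorization := inferInstanceAs (MorphismProperty.HasFactorization
        (generatingTrivialCofibrations k).rlp.llp (generatingTrivialCofibrations k).rlp) }

variable (k) in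
/-- The model structure on twisted complexes. -/
abbrev modelCategory : ModelCategory (TwistedComplex k) := ModelCategory.mk' _

attribute [local instance] modelCategory

/-! ### Factorizations, generation and properness -/

theorem isBicompleteWithFunctorialFactorizations :
    IsBicompleteWithFunctorialFactorizations (TwistedComplex k) where
  hasLimits := inferInstance
  hasColimits := inferInstance
  cofibration_trivialFibration := by
    change MorphismProperty.HasFunctorialFactorization (generatingCofibrations k).rlp.llp
      (trivialFibrations (TwistedComplex k))
    rw [trivialFibrations_eq]
    infer_instance
  trivialCofibration_fibration := by
    change MorphismProperty.HasFunctorialFactorization (trivialCofibrations (TwistedComplex k))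
      (generatingTrivialCofibrations k).rlp
    rw [trivialCofibrations_eq]
    infer_instance

theorem isGeneratedBy : IsGeneratedBy (generatingCofibrations k)
    (generatingTrivialCofibrations k) where
  trivialFibrations_eq := trivialFibrations_eq
  fibrations_eq := rfl

theorem isCombinatorial : IsCombinatorial (TwistedComplex k) where
  isLocallyPresentable := inferInstance
  isCofibrantlyGenerated := ⟨_, _, inferInstance, inferInstance, isGeneratedBy⟩

theorem mono_of_cofibration (F : A ⟶ B) [hF : Cofibration F] : Mono F :=
  mono_of_llp F ((cofibration_iff_llp F).1 hF)

theorem epi_of_fibration (F : A ⟶ B) [hF : Fibration F] : Epi F :=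
  ((generatingTrivialCofibrations_rlp_iff F).1 ((fibration_iff_rlp F).1 hF)).1

theorem isProper : IsProper (TwistedComplex k) where
  left {X Y Z T f g f' g'} sq hf hg := by
    -- Trivial cofibrations are stable under pushout anyway, so only the second factor `d.p` of `g`
    -- matters. It is an epimorphism, pushed out along a monomorphism.
    have d := MorphismProperty.factorizationData (trivialCofibrations (TwistedComplex k))
      (fibrations (TwistedComplex k)) g
    obtain ⟨_, _⟩ := (mem_trivialCofibrations_iff d.i).1 d.hi
    have : Fibration d.p := ⟨d.hp⟩
    have : WeakEquivalence d.p := weakEquivalence_of_precomp_of_fac d.fac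
    have sq₁ := IsPushout.of_hasPushout f d.i
    let u : pushout f d.i ⟶ T := pushout.desc f' (d.p ≫ g') (by rw [sq.w, ← Category.assoc, d.fac])
    have sq₂ : IsPushout d.p (pushout.inr f d.i) g' u := by
      refine (IsPushout.of_left (h₁₁ := d.i) (h₁₂ := d.p) (v₁₁ := f) (v₁₂ := pushout.inr f d.i)
        (v₁₃ := g') (h₂₁ := pushout.inl f d.i) (h₂₂ := u) ?_ ?_ sq₁.flip)
      · rw [d.fac, pushout.inl_desc]
        exact sq.flip
      · exact (pushout.inr_desc _ _ _).symm
    have := mono_of_cofibration (pushout.inr f d.i)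
    have := epi_of_fibration d.p
    have hu : WeakEquivalence u := (weakEquivalence_iff_quasiIso _).2
      (quasiIso_Tot_of_isPushout sq₂ ((weakEquivalence_iff_quasiIso _).1 inferInstance))
    rw [← pushout.inl_desc f' (d.p ≫ g') (by rw [sq.w, ← Category.assoc, d.fac])]
    infer_instance
  right {X Y Z T f' g' f g} sq hg hf := by
    -- Dually, trivial fibrations are stable under pullback, and the first factor `d.i` is a
    -- monomorphism pulled back along an epimorphism.
    have d := MorphismProperty.factorizationData (cofibrations (TwistedComplex k))
      (trivialFibrations (TwistedComplex k)) f
    obtain ⟨_, _⟩ := (mem_trivialFibrations_iff d.p).1 d.hp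
    have : Cofibration d.i := ⟨d.hi⟩
    have : WeakEquivalence d.i := weakEquivalence_of_postcomp_of_fac d.fac
    have sq₁ := IsPullback.of_hasPullback d.p g
    let u : X ⟶ pullback d.p g := pullback.lift (f' ≫ d.i) g' (by
      rw [Category.assoc, d.fac, sq.w])
    have sq₂ : IsPullback u f' (pullback.fst d.p g) d.i := by
      refine IsPullback.of_right (h₁₁ := u) (h₁₂ := pullback.snd d.p g) (v₁₁ := f')
        (v₁₂ := pullback.fst d.p g) (v₁₃ := g) (h₂₁ := d.i) (h₂₂ := d.p) ?_ ?_ sq₁.flip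
      · rw [d.fac, pullback.lift_snd]
        exact sq.flip
      · exact pullback.lift_fst _ _ _
    have := mono_of_cofibration d.i
    have := epi_of_fibration (pullback.fst d.p g)
    have hu : WeakEquivalence u := (weakEquivalence_iff_quasiIso _).2
      (quasiIso_Tot_of_isPullback sq₂ ((weakEquivalence_iff_quasiIso _).1 inferInstance))
    rw [← pullback.lift_snd (f' ≫ d.i) g' (by rw [Category.assoc, d.fac, sq.w])]
    infer_instance

/-! ### Cofibrant and fibrant objects, and the abelian conditions -/

theorem isCofibrant_iff_llp (X : TwistedComplex k) :
    IsCofibrant X ↔ (generatingCofibrations k).rlp.llp (0 : zero k ⟶ X) :=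
  (isCofibrant_iff_of_isInitial _ (isZero_zero k).isInitial).trans (cofibration_iff_llp _)

theorem isFibrant_iff_acyclic (X : TwistedComplex k) :
    IsFibrant X ↔ ∀ p : ℤ, 0 < p → ((vertical p).obj X).Acyclic :=
  (isFibrant_iff_of_isTerminal (0 : X ⟶ zero k) (isZero_zero k).isTerminal).trans
    ((fibration_iff_rlp _).trans
      (generatingTrivialCofibrations_rlp_iff_of_isZero _ (isZero_zero k)))

theorem cofibration_iff_mono (F : A ⟶ B) :
    Cofibration F ↔ Mono F ∧ IsCofibrant (cokernel F) := by
  rw [cofibration_iff_llp, isCofibrant_iff_llp]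
  exact ⟨fun h => ⟨mono_of_llp F h, MorphismProperty.of_isPushout (isPushout_cokernel F).flip h⟩,
    fun ⟨_, h⟩ => llp_of_mono F (isZero_zero k) _ h⟩

theorem fibration_iff_epi (F : A ⟶ B) : Fibration F ↔ Epi F ∧ IsFibrant (kernel F) := by
  rw [fibration_iff_rlp, generatingTrivialCofibrations_rlp_iff, isFibrant_iff_acyclic]

theorem isAbelianModelCategory : IsAbelianModelCategory (TwistedComplex k) where
  isAbelian := ⟨inferInstance, rfl⟩
  cofibration_iff := cofibration_iff_mono
  trivialCofibration_iff F := by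
    rw [cofibration_iff_mono, and_assoc]
    refine and_congr_right fun _ => and_congr_right fun _ => ?_
    rw [weakEquivalence_iff_quasiIso, weakEquivalence_iff_quasiIso, quasiIso_Tot_iff_cokernel,
      quasiIso_Tot_iff_of_isZero_source _ ((isZero_zero k).of_iso
        (initialIsInitial.uniqueUpToIso (isZero_zero k).isInitial))]
  fibration_iff := fibration_iff_epi
  trivialFibration_iff F := by
    rw [fibration_iff_epi, and_assoc]
    refine and_congr_right fun _ => and_congr_right fun _ => ?_
    rw [weakEquivalence_iff_quasiIso, weakEquivalence_iff_quasiIso, quasiIso_Tot_iff_kernel,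
      quasiIso_Tot_iff_of_isZero_target _ ((isZero_zero k).of_iso
        (terminalIsTerminal.uniqueUpToIso (isZero_zero k).isTerminal))]

theorem fibration_iff_surjective (F : A ⟶ B) :
    Fibration F ↔ (∀ p q : ℤ, Function.Surjective (F.f p q)) ∧ ∀ p q : ℤ, 0 < p →
      IsIso (HomologicalComplex.homologyMap ((vertical p).map F) q) := by
  rw [fibration_iff_rlp, generatingTrivialCofibrations_rlp_iff,
    surjective_and_isIso_homologyMap_iff F (0 < ·)]

theorem trivialFibration_iff_surjective (F : A ⟶ B) :
    (Fibration F ∧ WeakEquivalence F) ↔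
      (∀ p q : ℤ, Function.Surjective (F.f p q)) ∧ ∀ p q : ℤ, 0 ≤ p →
        IsIso (HomologicalComplex.homologyMap ((vertical p).map F) q) := by
  rw [← mem_trivialFibrations_iff, trivialFibrations_eq, generatingCofibrations_rlp_iff,
    surjective_and_isIso_homologyMap_iff F (0 ≤ ·)]

theorem cofibration_iff_injective (F : A ⟶ B) :
    Cofibration F ↔ (∀ p q : ℤ, Function.Injective (F.f p q)) ∧ IsCofibrant (cokernel F) := by
  rw [cofibration_iff_mono, mono_iff_injective]

theorem projective_of_isCofibrant (X : TwistedComplex k) (hX : IsCofibrant X) (p q : ℤ) :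
    Module.Projective k (X.X p q) :=
  projective_of_llp (isZero_zero k) _ ((isCofibrant_iff_llp X).1 hX) p q

end TwistedComplex

end

theorem theorem5 (k : Type u) [CommRing k] :
    ∃ _ : ModelCategory (TwistedComplex k),
      -- the model structure is proper, combinatorial and abelian
      IsBicompleteWithFunctorialFactorizations (TwistedComplex k) ∧
      IsProper (TwistedComplex k) ∧
      IsCombinatorial (TwistedComplex k) ∧
      IsAbelianModelCategory (TwistedComplex k) ∧
      -- weak equivalences
      (∀ {X Y : TwistedComplex k} (f : X ⟶ Y),
        WeakEquivalence f ↔ QuasiIso (TwistedComplex.Tot.map f)) ∧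
      -- fibrations
      (∀ {X Y : TwistedComplex k} (f : X ⟶ Y),
        Fibration f ↔
          (∀ p q : ℤ, Function.Surjective (f.f p q)) ∧
          ∀ p q : ℤ, 0 < p →
            IsIso (HomologicalComplex.homologyMap ((TwistedComplex.vertical p).map f) q)) ∧
      -- trivial fibrations
      (∀ {X Y : TwistedComplex k} (f : X ⟶ Y),
        (Fibration f ∧ WeakEquivalence f) ↔
          (∀ p q : ℤ, Function.Surjective (f.f p q)) ∧
          ∀ p q : ℤ, 0 ≤ p →
            IsIso (HomologicalComplex.homologyMap ((TwistedComplex.vertical p).map f) q)) ∧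
      -- cofibrations
      (∀ {X Y : TwistedComplex k} (f : X ⟶ Y),
        Cofibration f ↔
          (∀ p q : ℤ, Function.Injective (f.f p q)) ∧ IsCofibrant (cokernel f)) ∧
      -- cofibrant objects are pointwise projective
      (∀ X : TwistedComplex k, IsCofibrant X → ∀ p q : ℤ, Module.Projective k (X.X p q)) ∧
      -- generating cofibrations and generating trivial cofibrations
      IsGeneratedBy (TwistedComplex.generatingCofibrations k)
        (TwistedComplex.generatingTrivialCofibrations k) ∧
      -- the generating cofibrations are injective
      (∀ p q : ℤ, 0 ≤ p → ∀ a b : ℤ,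
        Function.Injective ((TwistedComplex.boundaryInclusion k p q).f a b)) ∧
      -- acyclicity of the vertical boundaries
      (∀ p q : ℤ, 0 < p →
        (TwistedComplex.Tot.obj (TwistedComplex.boundary k p q)).Acyclic) := by
  refine ⟨TwistedComplex.modelCategory k, ?_⟩
  exact ⟨TwistedComplex.isBicompleteWithFunctorialFactorizations, TwistedComplex.isProper,
    TwistedComplex.isCombinatorial, TwistedComplex.isAbelianModelCategory,
    TwistedComplex.weakEquivalence_iff_quasiIso, TwistedComplex.fibration_iff_surjective,
    TwistedComplex.trivialFibration_iff_surjective, TwistedComplex.cofibration_iff_injective,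
    TwistedComplex.projective_of_isCofibrant, TwistedComplex.isGeneratedBy,
    TwistedComplex.boundaryInclusion_injective, TwistedComplex.Tot_boundary_acyclic⟩
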